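/- **Model.** In the (non-uniform) low-space MPC model, an algorithm uses, on graphs with node set $\{0,\dots,n-1\}$, a finite set of machines that work in synchronous rounds. For constants $0<\delta<1$ and $b,c\in\mathbb N$, every machine has a local memory of $S=\lfloor n^{\delta}\rfloor$ words, a word being a natural number below $n^{b}$ (that is, $O(\log n)$ bits). The edges of the input graph are initially partitioned among the machines in an arbitrary way that respects the local memories; special nodes of the input, if any, are known to all machines. In each round every machine sends messages of at most $S$ words in total, receives at most $S$ words in total, and performs an arbitrary local computation, after which its memory again holds at most $S$ words; at the end a designated machine announces the answer. The global memory is $\mathrm{poly}(n)$ if (number of machines)$\,\cdot S\le n^{c}$ for all large $n$. A randomized algorithm may depend on a shared, uniformly random seed from a finite set; a deterministic one has no seed. An algorithm solves a problem (deterministically, resp. with high probability) if, for all sufficiently large $n$ and every admissible input on $n$ nodes, the input fits into the memories of the machines and, for every initial distribution of it, the execution obeys all limits and announces the correct answer (always, resp. with probability at least $1-1/n$). **Conjecture (1 vs. 2 cycles).** Every randomized low-space MPC algorithm (for any constant $0<\delta<1$) with $\mathrm{poly}(n)$ global memory that, for even $n$, decides with high probability whether the input graph is a cycle on $n$ nodes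 or consists of two disjoint cycles on $n/2$ nodes each takes $\Omega(\log n)$ rounds. **Problem ($D$-diameter $s$-$t$ path-connectivity).** Let $D:\mathbb N\to\mathbb N$ satisfy $D(n)\in\Omega(\log n)$ and $D(n)=n^{o(1)}$, and let $C>0$ be a constant. The input is a graph on $n$ nodes each of whose connected components is a path of diameter at most $C\cdot D(n)$, with two distinct special nodes $s,t$ of degree $1$. The answer is YES if $s$ and $t$ are in the same connected component, and NO otherwise. **Lemma.** Assume that the 1 vs. 2 cycles conjecture holds. Then for every such $D$ and $C$, and for every constant $0<\delta<1$, there is no deterministic low-space MPC algorithm with $\mathrm{poly}(n)$ global memory that solves the $D$-diameter $s$-$t$ path-connectivity problem in $o(\log D(n))$ rounds. -/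

import Mathlib

open Filter Topology Asymptotics

/-- A (possibly randomized) algorithm in the massively parallel computation (MPC) model, for inputs
on `n` nodes.  The set of machines, the seed space and the (arbitrary, also non-uniform) local
computations may depend on `n`.  The content of a memory and every message is a list of words, and a
word is a natural number; all size limits are imposed by `MPCAlgorithm.Respects`.
The seed is drawn uniformly and is shared by all machines. -/
structure MPCAlgorithm where
  /-- the machines used on inputs with `n` nodes -/
  Machine : ℕ → Type
  /-- the random seeds used on inputs with `n` nodes -/
  Seed : ℕ → Type
  [fintypeMachine : ∀ n, Fintype (Machine n)]
  [fintypeSeed : ∀ n, Fintype (Seed n)]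
  [nonemptySeed : ∀ n, Nonempty (Seed n)]
  /-- the number of synchronous rounds on inputs with `n` nodes -/
  rounds : ℕ → ℕ
  /-- `send n ω r i m j` is the message that machine `i` with memory content `m` sends to
  machine `j` in round `r` -/
  send : (n : ℕ) → Seed n → ℕ → Machine n → List ℕ → Machine n → List ℕ
  /-- `update n ω r i m inbox` is the memory content of machine `i` after round `r`, if it was `m`
  before that round and `inbox j` is the message received from machine `j` -/
  update : (n : ℕ) → Seed n → ℕ → Machine n → List ℕ → (Machine n → List ℕ) → List ℕ
  /-- the machine that announces the answer -/
  outMachine : (n : ℕ) → Machine n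
  /-- the answer, read off the final memory content of the announcing machine -/
  answer : (n : ℕ) → Seed n → List ℕ → Bool

namespace MPCAlgorithm

attribute [instance] fintypeMachine fintypeSeed nonemptySeed

/-- An algorithm is deterministic if there is only one seed. -/
def IsDeterministic (A : MPCAlgorithm) : Prop := ∀ n, Subsingleton (A.Seed n)

/-- The contents of all memories after `r` rounds, from the initial contents `start`. -/
def mem (A : MPCAlgorithm) (n : ℕ) (ω : A.Seed n) (start : A.Machine n → List ℕ) :
    ℕ → A.Machine n → List ℕ
  | 0 => start
  | r + 1 => fun i =>
      A.update n ω r i (A.mem n ω start r i) (fun j => A.send n ω r j (A.mem n ω start r j) i)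

/-- The message sent from machine `i` to machine `j` in round `r` of the execution. -/
def msg (A : MPCAlgorithm) (n : ℕ) (ω : A.Seed n) (start : A.Machine n → List ℕ) (r : ℕ)
    (i j : A.Machine n) : List ℕ :=
  A.send n ω r i (A.mem n ω start r i) j

/-- The execution obeys the limits of machines with local memory `S` whose words are numbers below
`W`: at all times every memory holds at most `S` words, and in every round every machine sends at
most `S` words in total and receives at most `S` words in total. -/
def Respects (A : MPCAlgorithm) (n S W : ℕ) (ω : A.Seed n) (start : A.Machine n → List ℕ) :
    Prop :=
  (∀ r ≤ A.rounds n, ∀ i,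
    (A.mem n ω start r i).length ≤ S ∧ ∀ w ∈ A.mem n ω start r i, w < W) ∧
  (∀ r < A.rounds n, ∀ i,
    ∑ j, (A.msg n ω start r i j).length ≤ S ∧
    ∑ j, (A.msg n ω start r j i).length ≤ S ∧
    ∀ j, ∀ w ∈ A.msg n ω start r i j, w < W)

/-- The answer announced at the end of the execution. -/
def output (A : MPCAlgorithm) (n : ℕ) (ω : A.Seed n) (start : A.Machine n → List ℕ) : Bool :=
  A.answer n ω (A.mem n ω start (A.rounds n) (A.outMachine n))

end MPCAlgorithm

open Classical in
/-- `start` is a distribution of the input among the machines `M`: the input is a graph `G` with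
node set `{0, …, n - 1}` and a list `special` of special nodes.  The edges of `G` are partitioned
among the machines in an arbitrary way; every machine holds the list of its edges (each as the two
words naming its endpoints, in any order) and, in front of it, the special nodes. -/
def IsInputDistribution {M : Type} [Fintype M] {n : ℕ} (G : SimpleGraph (Fin n))
    (special : List (Fin n)) (start : M → List ℕ) : Prop :=
  ∃ L : M → List (Fin n × Fin n),
    ∑ i, (L i : Multiset (Fin n × Fin n)).map (fun e => s(e.1, e.2)) = G.edgeFinset.val ∧
    ∀ i, start i = special.map (fun v => (v : ℕ)) ++
      (L i).flatMap (fun e => [(e.1 : ℕ), (e.2 : ℕ)])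

/-- A decision problem (with a promise) on graphs with a list of special nodes:
`inst n G special ans` says that `(G, special)` is an admissible input whose correct answer
is `ans`. -/
structure GraphProblem where
  inst : (n : ℕ) → SimpleGraph (Fin n) → List (Fin n) → Bool → Prop

/-- The local memory, in words, of the low-space regime: `n ^ δ` (rounded down). -/
noncomputable def localMemory (δ : ℝ) (n : ℕ) : ℕ := ⌊(n : ℝ) ^ δ⌋₊

namespace MPCAlgorithm

/-- The global memory (number of machines times local memory) is at most `n ^ c` words. -/
def GlobalMemoryLE (A : MPCAlgorithm) (δ : ℝ) (c : ℕ) : Prop :=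
  ∀ᶠ n in atTop, Fintype.card (A.Machine n) * localMemory δ n ≤ n ^ c

/-- On the seed `ω`, the execution obeys all limits (local memory `n ^ δ` words, words below
`n ^ b`) and announces `ans`. -/
def Succeeds (A : MPCAlgorithm) (δ : ℝ) (b n : ℕ) (start : A.Machine n → List ℕ) (ans : Bool)
    (ω : A.Seed n) : Prop :=
  A.Respects n (localMemory δ n) (n ^ b) ω start ∧ A.output n ω start = ans

/-- The algorithm satisfies `good` on all sufficiently large inputs: the input can be stored in the
local memories of the machines, and however it is distributed among these memories, `good` holds
for the set of seeds on which the execution succeeds. -/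
def SolvesWith (A : MPCAlgorithm) (δ : ℝ) (b : ℕ) (P : GraphProblem)
    (good : (n : ℕ) → Set (A.Seed n) → Prop) : Prop :=
  ∀ᶠ n in atTop, ∀ (G : SimpleGraph (Fin n)) (special : List (Fin n)) (ans : Bool),
    P.inst n G special ans →
    (∃ start : A.Machine n → List ℕ, IsInputDistribution G special start ∧
      ∀ i, (start i).length ≤ localMemory δ n) ∧
    ∀ start : A.Machine n → List ℕ, IsInputDistribution G special start →
      (∀ i, (start i).length ≤ localMemory δ n) →
      good n {ω | A.Succeeds δ b n start ans ω}

/-- The algorithm solves `P` with certainty (on every seed). -/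
def Solves (A : MPCAlgorithm) (δ : ℝ) (b : ℕ) (P : GraphProblem) : Prop :=
  A.SolvesWith δ b P (fun _ good => ∀ ω, ω ∈ good)

/-- The algorithm solves `P` with high probability: for every input, a uniformly random seed is
successful with probability at least `1 - 1 / n`. -/
def SolvesWHP (A : MPCAlgorithm) (δ : ℝ) (b : ℕ) (P : GraphProblem) : Prop :=
  A.SolvesWith δ b P (fun n good =>
    (1 - 1 / (n : ℝ)) ≤ (good.ncard : ℝ) / (Fintype.card (A.Seed n) : ℝ))

end MPCAlgorithm

/-- The 1 vs. 2 cycles problem: for even `n = 2 * k`, decide whether the graph is a cycle on `n`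
nodes (answer `true`) or consists of two disjoint cycles on `n / 2` nodes (answer `false`). -/
def oneVsTwoCycles : GraphProblem where
  inst n G special ans := special = [] ∧ ∃ k : ℕ, 3 ≤ k ∧ n = 2 * k ∧
    ((ans = true ∧ Nonempty (G ≃g SimpleGraph.cycleGraph n)) ∨
     (ans = false ∧
      Nonempty (G ≃g (SimpleGraph.cycleGraph k ⊕g SimpleGraph.cycleGraph k))))

/-- The 1 vs. 2 cycles conjecture: every randomized low-space MPC algorithm with polynomial global
memory that solves the 1 vs. 2 cycles problem with high probability takes `Ω(log n)` rounds
(`n = 2 * k` being even). -/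
def OneVsTwoCyclesConjecture : Prop :=
  ∀ (δ : ℝ) (b c : ℕ) (A : MPCAlgorithm), 0 < δ → δ < 1 →
    A.GlobalMemoryLE δ c → A.SolvesWHP δ b oneVsTwoCycles →
    (fun k : ℕ => Real.log ((2 * k : ℕ) : ℝ)) =O[atTop] (fun k : ℕ => (A.rounds (2 * k) : ℝ))

/-- Every connected component of `G` is a path, of diameter (number of edges) at most `d`. -/
def IsPathCollection {V : Type*} (G : SimpleGraph V) (d : ℝ) : Prop :=
  ∀ K : G.ConnectedComponent, ∃ ℓ : ℕ, (ℓ : ℝ) ≤ d ∧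
    Nonempty (G.induce K.supp ≃g SimpleGraph.pathGraph (ℓ + 1))

/-- The `D`-diameter `s`-`t` path-connectivity problem, with constant `C` in the bound `O(D)`:
the graph is a collection of paths of diameter at most `C * D n`, and `s`, `t` are two nodes of
degree one.  The answer is `true` if and only if `s` and `t` are in the same component. -/
def pathConnectivity (C : ℝ) (D : ℕ → ℕ) : GraphProblem where
  inst n G special ans := ∃ s t : Fin n, special = [s, t] ∧ s ≠ t ∧
    IsPathCollection G (C * D n) ∧ (G.neighborSet s).ncard = 1 ∧ (G.neighborSet t).ncard = 1 ∧
    (ans = true ↔ G.Reachable s t)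

/-!
The proof turns a fast algorithm `A` for path connectivity into an algorithm for the 1 vs. 2 cycles
problem with `o(log n)` rounds; the reduction is deterministic.

**Cycles and permutations.** In a graph all of whose degrees are two, following a dart (a node with
one of its two ports) and leaving the node reached through the other port is a permutation `σ` of
the `2 * n` darts (`dartPerm`).  On `n = 2 * k` nodes, the traversal of length `k` returns to the
node where it started if the graph consists of two cycles, and does not if it is a single cycle
(`dartPerm_pow_eq_iff`).  So it suffices to compute `σ ^ k`.

**Products of permutations by path connectivity.** For permutations `h 0, …, h (R - 1)` of a set
`X`, the layered graph on `X × {0, …, R}` with the edges `(x, i) — (h i x, i + 1)` is a collection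
of disjoint paths of length `R`, whatever the permutations are, and `(s, 0)` is connected to
`(t, R)` if and only if the product of the permutations maps `s` to `t`
(`pathConnectivity_inst_layered`). Running `A` in parallel for all pairs `(s, t)` thus yields the
product of up to `C * D N` permutations in `A.rounds N + O(1)` rounds (`computes_simulation`).
Here `N` is the number of nodes of the layered graph together with isolated nodes that pad it; as
`D N = N ^ o(1)`, it can be chosen as `n ^ (1 + γ)` for a small `γ > 0`, so that a machine with
`n ^ ((2 + δ) / 3)` words of memory can simulate one with `N ^ δ` words. The layered graph always
has its edges at the same machines; these learn the permutations through a broadcast tree of depth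
four, with a fan-out of order `√n`.

**Powers.** With `R = 2 * r`, one application of `A` leads from `g` to `σ ^ d * g ^ r`, where
`d < r`. By Horner's rule, `log n / log r + 1` applications compute `σ ^ k` (`computes_pow`). As
`log r` is of the order of `log (D N)` and `A` takes `o(log (D N))` rounds, this amounts to
`o(log n)` rounds (`rounds_isLittleO`), which contradicts the conjecture.

Since local computations are arbitrary functions, algorithms are constructed from the configurations
they go through: a round is possible as soon as the messages of a machine are determined by its
memory, and its new memory by the old one and the messages received (`OneRound`).  The local
computations are then obtained by choice (`Computes.exists_protocol`).
-/


/-! ### Computations described by their configurations -/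

section Framework

variable {Θ M : Type}

/-- A family of configurations, one for every possible input `θ`, respects the memory size `S` and
the word bound `W`. -/
def Fits (S W : ℕ) (F : Θ → M → List ℕ) : Prop :=
  ∀ θ i, (F θ i).length ≤ S ∧ ∀ w ∈ F θ i, w < W

/-- One MPC round can lead from the configuration `F θ` to the configuration `G θ`, for every input
`θ` simultaneously.  As local computations are arbitrary functions, it suffices that the messages of
a machine are *determined* by its memory content, and that its new memory content is determined by
the old one and the messages received. -/
def OneRound [Fintype M] (S W : ℕ) (F G : Θ → M → List ℕ) : Prop :=
  ∃ msg : Θ → M → M → List ℕ,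
    (∀ θ θ' i, F θ i = F θ' i → msg θ i = msg θ' i) ∧
    (∀ θ θ' i, F θ i = F θ' i → (∀ j, msg θ j i = msg θ' j i) → G θ i = G θ' i) ∧
    ∀ θ i, ∑ j, (msg θ i j).length ≤ S ∧ ∑ j, (msg θ j i).length ≤ S ∧
      ∀ j, ∀ w ∈ msg θ i j, w < W

/-- `R` rounds lead from the configuration `F θ` to the configuration `G θ`, for every input `θ`
simultaneously; `st r θ` is the configuration after `r` rounds. -/
def Computes [Fintype M] (S W R : ℕ) (F G : Θ → M → List ℕ) : Prop :=
  ∃ st : ℕ → Θ → M → List ℕ, st 0 = F ∧ st R = G ∧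
    (∀ r < R, OneRound S W (st r) (st (r + 1))) ∧ ∀ r ≤ R, Fits S W (st r)

theorem Computes.refl [Fintype M] {S W : ℕ} {F : Θ → M → List ℕ} (h : Fits S W F) :
    Computes S W 0 F F :=
  ⟨fun _ => F, rfl, rfl, by simp, fun _ _ => h⟩

theorem Computes.step [Fintype M] {S W R : ℕ} {F G H : Θ → M → List ℕ}
    (h : Computes S W R F G) (h₁ : OneRound S W G H) (hH : Fits S W H) :
    Computes S W (R + 1) F H := by
  obtain ⟨st, rfl, rfl, hst, hfit⟩ := h
  refine ⟨fun r => if r ≤ R then st r else H, by simp, by simp, fun r hr => ?_, fun r hr => ?_⟩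
  · rcases Nat.lt_succ_iff_lt_or_eq.mp hr with h | rfl
    · simpa [h.le, Nat.succ_le_of_lt h] using hst r h
    · simpa using h₁
  · by_cases h : r ≤ R
    · simpa [h] using hfit r h
    · simpa [h] using hH

theorem Computes.trans [Fintype M] {S W R R' : ℕ} {F G H : Θ → M → List ℕ}
    (h : Computes S W R F G) (h' : Computes S W R' G H) : Computes S W (R + R') F H := by
  obtain ⟨st, rfl, rfl, hst, hfit⟩ := h'
  have key : ∀ r ≤ R', Computes S W (R + r) F (st r) := by
    intro r
    induction r with
    | zero => exact fun _ => h
    | succ r ih => exact fun hr => (ih (by omega)).step (hst r (by omega)) (hfit _ hr)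
  exact key R' le_rfl

/-- The contents of all memories after `r` rounds of the local computations `send`, `update`. -/
def runMem (send : ℕ → M → List ℕ → M → List ℕ) (update : ℕ → M → List ℕ → (M → List ℕ) → List ℕ)
    (start : M → List ℕ) : ℕ → M → List ℕ
  | 0 => start
  | r + 1 => fun i => update r i (runMem send update start r i)
      (fun j => send r j (runMem send update start r j) i)

/-- Local computations that realize a computation given by its configurations. -/
theorem Computes.exists_protocol [Fintype M] {S W R : ℕ} {F G : Θ → M → List ℕ}
    (h : Computes S W R F G) :
    ∃ (send : ℕ → M → List ℕ → M → List ℕ)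
      (update : ℕ → M → List ℕ → (M → List ℕ) → List ℕ), ∀ θ,
      runMem send update (F θ) R = G θ ∧
      (∀ r ≤ R, ∀ i, (runMem send update (F θ) r i).length ≤ S ∧
        ∀ w ∈ runMem send update (F θ) r i, w < W) ∧
      ∀ r < R, ∀ i,
        ∑ j, (send r i (runMem send update (F θ) r i) j).length ≤ S ∧
        ∑ j, (send r j (runMem send update (F θ) r j) i).length ≤ S ∧
        ∀ j, ∀ w ∈ send r i (runMem send update (F θ) r i) j, w < W := by
  classical
  obtain ⟨st, rfl, rfl, hst, hfit⟩ := h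
  have hst' : ∀ r, ∃ msg : Θ → M → M → List ℕ, r < R →
      (∀ θ θ' i, st r θ i = st r θ' i → msg θ i = msg θ' i) ∧
      (∀ θ θ' i, st r θ i = st r θ' i → (∀ j, msg θ j i = msg θ' j i) →
        st (r + 1) θ i = st (r + 1) θ' i) ∧
      ∀ θ i, ∑ j, (msg θ i j).length ≤ S ∧ ∑ j, (msg θ j i).length ≤ S ∧
        ∀ j, ∀ w ∈ msg θ i j, w < W := by
    intro r
    by_cases hr : r < R
    · obtain ⟨msg, h⟩ := hst r hr
      exact ⟨msg, fun _ => h⟩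
    · exact ⟨fun _ _ _ => [], fun h => absurd h hr⟩
  choose msg hmsg using hst'
  let send : ℕ → M → List ℕ → M → List ℕ := fun r i m j =>
    if h : ∃ θ, st r θ i = m then msg r h.choose i j else []
  let update : ℕ → M → List ℕ → (M → List ℕ) → List ℕ := fun r i m inbox =>
    if h : ∃ θ, st r θ i = m ∧ ∀ j, msg r θ j i = inbox j then st (r + 1) h.choose i else []
  have hsend : ∀ r < R, ∀ θ i j, send r i (st r θ i) j = msg r θ i j := by
    intro r hr θ i j
    have h : ∃ θ', st r θ' i = st r θ i := ⟨θ, rfl⟩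
    simp only [send, dif_pos h]
    rw [(hmsg r hr).1 _ θ i h.choose_spec]
  have hrun : ∀ θ, ∀ r ≤ R, runMem send update (st 0 θ) r = st r θ := by
    intro θ r
    induction r with
    | zero => exact fun _ => rfl
    | succ r ih =>
      intro hr
      have hr' : r < R := hr
      funext i
      simp only [runMem, ih hr'.le]
      have h : ∃ θ', st r θ' i = st r θ i ∧
          ∀ j, msg r θ' j i = send r j (st r θ j) i :=
        ⟨θ, rfl, fun j => (hsend r hr' θ j i).symm⟩
      simp only [update, dif_pos h]
      exact (hmsg r hr').2.1 _ θ i h.choose_spec.1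
        (fun j => (h.choose_spec.2 j).trans (hsend r hr' θ j i))
  refine ⟨send, update, fun θ => ⟨hrun θ R le_rfl, fun r hr i => ?_, fun r hr i => ?_⟩⟩
  · rw [hrun θ r hr]
    exact hfit r hr θ i
  · simp only [hrun θ r hr.le, hsend r hr]
    exact (hmsg r hr).2.2 θ i

theorem sum_le_card_mul_of_support {ι : Type*} [Fintype ι] (f : ι → ℕ) (T : Finset ι) (L B : ℕ)
    (hT : ∀ i, f i ≠ 0 → i ∈ T) (hL : ∀ i, f i ≤ L) (hB : T.card * L ≤ B) : ∑ i, f i ≤ B := by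
  rw [← Finset.sum_subset (Finset.subset_univ T)
    (fun i _ hi => by_contra fun h => hi (hT i h))]
  exact (Finset.sum_le_card_nsmul T f L fun i _ => hL i).trans (by simpa using hB)

theorem of_length_ite_ne_zero {p : Prop} [Decidable p] {l : List ℕ}
    (h : (if p then l else []).length ≠ 0) : p :=
  by_contra fun hp => h (by rw [if_neg hp, List.length_nil])

/-- A round in which every machine `j` gets the memory contents (of at most `L` words) of the
machines in `src j`. -/
theorem OneRound.pull [Fintype M] [DecidableEq M] {S W : ℕ} {F G : Θ → M → List ℕ}
    (src : M → Finset M) (L : ℕ) (hF : Fits S W F)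
    (hL : ∀ θ i j, i ∈ src j → (F θ i).length ≤ L)
    (hin : ∀ j, (src j).card * L ≤ S)
    (hout : ∀ i, ∃ T : Finset M, (∀ j, i ∈ src j → j ∈ T) ∧ T.card * L ≤ S)
    (hG : ∀ θ θ' j, F θ j = F θ' j → (∀ i ∈ src j, F θ i = F θ' i) → G θ j = G θ' j) :
    OneRound S W F G := by
  refine ⟨fun θ i j => if i ∈ src j then F θ i else [], ?_, ?_, ?_⟩
  · intro θ θ' i h
    funext j
    simp [h]
  · intro θ θ' i h h'
    refine hG θ θ' i h fun j hj => ?_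
    simpa [hj] using h' j
  · have hlen : ∀ θ i j, (if i ∈ src j then F θ i else []).length ≤ L := by
      intro θ i j
      split_ifs with h
      · exact hL θ i j h
      · simp
    refine fun θ i => ⟨?_, ?_, ?_⟩
    · obtain ⟨T, hT, hcard⟩ := hout i
      exact sum_le_card_mul_of_support _ T L S
        (fun j hj => hT j (of_length_ite_ne_zero hj)) (fun j => hlen θ i j) hcard
    · exact sum_le_card_mul_of_support _ _ L S
        (fun j hj => of_length_ite_ne_zero hj) (fun j => hlen θ j i) (hin i)
    · intro j w hw
      beta_reduce at hw
      split_ifs at hw with h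
      · exact (hF θ i).2 w hw
      · simp at hw

end Framework

/-! ### Disjoint paths -/

section Paths

variable {V X : Type} {R : ℕ}

/-- The graph on `V` that consists of the disjoint paths `q (x, 0), …, q (x, R)` for `x : X`, and of
isolated nodes. -/
def pathsGraph (q : X × Fin (R + 1) ↪ V) : SimpleGraph V where
  Adj u v := ∃ x i j, (SimpleGraph.pathGraph (R + 1)).Adj i j ∧ u = q (x, i) ∧ v = q (x, j)
  symm := ⟨by
    rintro u v ⟨x, i, j, h, hu, hv⟩
    exact ⟨x, j, i, h.symm, hv, hu⟩⟩
  loopless := ⟨by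
    rintro u ⟨x, i, j, h, hu, hv⟩
    have := q.injective (hu.symm.trans hv)
    simp only [Prod.mk.injEq, true_and] at this
    exact h.ne this⟩

variable (q : X × Fin (R + 1) ↪ V)

theorem pathsGraph_adj_iff {x y : X} {i j : Fin (R + 1)} :
    (pathsGraph q).Adj (q (x, i)) (q (y, j)) ↔
      x = y ∧ (SimpleGraph.pathGraph (R + 1)).Adj i j := by
  constructor
  · rintro ⟨z, i', j', h, hu, hv⟩
    have h₁ := q.injective hu
    have h₂ := q.injective hv
    simp only [Prod.mk.injEq] at h₁ h₂
    obtain ⟨rfl, rfl⟩ := h₁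
    obtain ⟨rfl, rfl⟩ := h₂
    exact ⟨rfl, h⟩
  · rintro ⟨rfl, h⟩
    exact ⟨x, i, j, h, rfl, rfl⟩

theorem pathsGraph_reachable_same (x : X) (i j : Fin (R + 1)) :
    (pathsGraph q).Reachable (q (x, i)) (q (x, j)) := by
  have h : (SimpleGraph.pathGraph (R + 1)).Reachable i j :=
    (SimpleGraph.pathGraph_connected R).preconnected i j
  let f : SimpleGraph.pathGraph (R + 1) →g pathsGraph q :=
    ⟨fun i => q (x, i), fun {a b} h => (pathsGraph_adj_iff q).2 ⟨rfl, h⟩⟩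
  exact h.map f

theorem exists_of_pathsGraph_reachable {x : X} {i : Fin (R + 1)} {v : V}
    (h : (pathsGraph q).Reachable (q (x, i)) v) : ∃ j, v = q (x, j) := by
  obtain ⟨w⟩ := h
  suffices ∀ u v, (pathsGraph q).Walk u v → (∃ i, u = q (x, i)) → ∃ j, v = q (x, j) from
    this _ _ w ⟨i, rfl⟩
  intro u v w
  induction w with
  | nil => exact id
  | cons h _ ih =>
    rintro ⟨i, rfl⟩
    obtain ⟨y, i', j', -, hu, hv⟩ := h
    have h₁ := q.injective hu
    simp only [Prod.mk.injEq] at h₁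
    obtain ⟨rfl, rfl⟩ := h₁
    exact ih ⟨j', hv⟩

theorem pathsGraph_reachable_iff {x y : X} {i j : Fin (R + 1)} :
    (pathsGraph q).Reachable (q (x, i)) (q (y, j)) ↔ x = y := by
  constructor
  · intro h
    obtain ⟨j', h'⟩ := exists_of_pathsGraph_reachable q h
    have := q.injective h'
    simp only [Prod.mk.injEq] at this
    exact this.1.symm
  · rintro rfl
    exact pathsGraph_reachable_same q x i j

theorem pathsGraph_isPathCollection {d : ℝ} (hd : (R : ℝ) ≤ d) :
    IsPathCollection (pathsGraph q) d := by
  intro K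
  induction K using SimpleGraph.ConnectedComponent.ind with
  | h v =>
  by_cases hv : v ∈ Set.range q
  · obtain ⟨⟨x, i⟩, rfl⟩ := hv
    refine ⟨R, hd, ⟨SimpleGraph.Iso.symm ?_⟩⟩
    have hmem : ∀ j, q (x, j) ∈ ((pathsGraph q).connectedComponentMk (q (x, i))).supp := fun j =>
      SimpleGraph.ConnectedComponent.eq.2 (pathsGraph_reachable_same q x j i)
    refine ⟨Equiv.ofBijective (fun j => ⟨q (x, j), hmem j⟩) ⟨fun a b h => ?_, fun w => ?_⟩, ?_⟩
    · simpa using h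
    · obtain ⟨j, hj⟩ := exists_of_pathsGraph_reachable q
        (SimpleGraph.ConnectedComponent.eq.1 w.2).symm
      exact ⟨j, Subtype.ext hj.symm⟩
    · intro a b
      exact (pathsGraph_adj_iff q).trans (and_iff_right rfl)
  · -- a node outside the paths is isolated, that is, a path of diameter zero
    refine ⟨0, by simpa using (Nat.cast_nonneg R).trans hd, ⟨?_⟩⟩
    have huniq : ∀ w ∈ ((pathsGraph q).connectedComponentMk v).supp, w = v := by
      intro w hw
      obtain ⟨p⟩ := (SimpleGraph.ConnectedComponent.eq.1 hw).symm
      cases p with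
      | nil => rfl
      | cons h _ =>
        obtain ⟨x, i, -, -, h, -⟩ := h
        exact absurd ⟨_, h.symm⟩ hv
    have : Unique ((pathsGraph q).connectedComponentMk v).supp :=
      ⟨⟨⟨v, rfl⟩⟩, fun w => Subtype.ext (huniq w w.2)⟩
    refine ⟨Equiv.ofUnique _ (Fin 1), ?_⟩
    intro a b
    have hab : a = b := Subsingleton.elim a b
    subst hab
    simp

theorem pathsGraph_ncard_neighborSet_zero (hR : 1 ≤ R) (x : X) :
    ((pathsGraph q).neighborSet (q (x, 0))).ncard = 1 := by
  rw [Set.ncard_eq_one]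
  refine ⟨q (x, ⟨1, by omega⟩), ?_⟩
  ext v
  simp only [SimpleGraph.mem_neighborSet, Set.mem_singleton_iff]
  constructor
  · rintro ⟨y, i, j, h, hu, rfl⟩
    have h₁ := q.injective hu
    simp only [Prod.mk.injEq] at h₁
    obtain ⟨rfl, rfl⟩ := h₁
    rw [SimpleGraph.pathGraph_adj] at h
    congr 2
    ext
    simp at h ⊢
    omega
  · rintro rfl
    rw [pathsGraph_adj_iff, SimpleGraph.pathGraph_adj]
    simp

theorem pathsGraph_ncard_neighborSet_last (hR : 1 ≤ R) (x : X) :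
    ((pathsGraph q).neighborSet (q (x, Fin.last R))).ncard = 1 := by
  rw [Set.ncard_eq_one]
  refine ⟨q (x, ⟨R - 1, by omega⟩), ?_⟩
  ext v
  simp only [SimpleGraph.mem_neighborSet, Set.mem_singleton_iff]
  constructor
  · rintro ⟨y, i, j, h, hu, rfl⟩
    have h₁ := q.injective hu
    simp only [Prod.mk.injEq] at h₁
    obtain ⟨rfl, rfl⟩ := h₁
    rw [SimpleGraph.pathGraph_adj] at h
    congr 2
    ext
    have := j.2
    simp at h ⊢
    omega
  · rintro rfl
    rw [pathsGraph_adj_iff, SimpleGraph.pathGraph_adj]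
    simp
    omega

/-! ### Layered graphs of a sequence of permutations -/

/-- The product `h (i - 1) * ⋯ * h 1 * h 0`. -/
def permProd (h : ℕ → Equiv.Perm X) : ℕ → Equiv.Perm X
  | 0 => 1
  | i + 1 => h i * permProd h i

/-- The path of the layered graph of `h` that starts at `x` has in layer `i` the node
`permProd h i x`. -/
def layerEmb (ι : X × Fin (R + 1) ↪ V) (h : ℕ → Equiv.Perm X) : X × Fin (R + 1) ↪ V where
  toFun p := ι (permProd h p.2 p.1, p.2)
  inj' := by
    rintro ⟨x, i⟩ ⟨y, j⟩ hxy
    have := ι.injective hxy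
    simp only [Prod.mk.injEq] at this ⊢
    obtain ⟨h₁, rfl⟩ := this
    exact ⟨(permProd h i).injective h₁, rfl⟩

/-- The edge of the layered graph of `h` that leads from the node `x` of layer `i` to the next
layer, as an ordered pair. -/
def layerEdge (ι : X × Fin (R + 1) ↪ V) (h : ℕ → Equiv.Perm X) (p : X × Fin R) : V × V :=
  (ι (p.1, p.2.castSucc), ι (h p.2 p.1, p.2.succ))

variable (ι : X × Fin (R + 1) ↪ V) (h : ℕ → Equiv.Perm X)

theorem mem_edgeSet_pathsGraph_layerEmb (e : Sym2 V) :
    e ∈ (pathsGraph (layerEmb ι h)).edgeSet ↔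
      ∃ p, s((layerEdge ι h p).1, (layerEdge ι h p).2) = e := by
  induction e using Sym2.ind with
  | _ u v =>
  rw [SimpleGraph.mem_edgeSet]
  have key : ∀ (x : X) (i : Fin R),
      layerEdge ι h (permProd h i x, i) =
        (layerEmb ι h (x, i.castSucc), layerEmb ι h (x, i.succ)) := by
    intro x i
    rfl
  constructor
  · rintro ⟨x, i, j, hij, rfl, rfl⟩
    rw [SimpleGraph.pathGraph_adj] at hij
    rcases hij with hij | hij
    · obtain ⟨i, rfl⟩ : ∃ i' : Fin R, i = i'.castSucc := ⟨⟨i, by omega⟩, rfl⟩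
      obtain rfl : j = i.succ := Fin.ext hij.symm
      exact ⟨(permProd h i x, i), by rw [key]⟩
    · obtain ⟨j, rfl⟩ : ∃ j' : Fin R, j = j'.castSucc := ⟨⟨j, by omega⟩, rfl⟩
      obtain rfl : i = j.succ := Fin.ext hij.symm
      exact ⟨(permProd h j x, j), by rw [key, Sym2.eq_swap]⟩
  · rintro ⟨⟨y, i⟩, hp⟩
    have := key ((permProd h i).symm y) i
    rw [Equiv.apply_symm_apply] at this
    rw [this] at hp
    have hadj : (pathsGraph (layerEmb ι h)).Adj (layerEmb ι h ((permProd h i).symm y, i.castSucc))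
        (layerEmb ι h ((permProd h i).symm y, i.succ)) := by
      rw [pathsGraph_adj_iff, SimpleGraph.pathGraph_adj]
      simp
    rwa [← SimpleGraph.mem_edgeSet, hp] at hadj

theorem layerEdge_sym2_injective :
    Function.Injective fun p => s((layerEdge ι h p).1, (layerEdge ι h p).2) := by
  rintro ⟨x, i⟩ ⟨y, j⟩ hxy
  simp only [layerEdge, Sym2.eq_iff] at hxy
  rcases hxy with ⟨h₁, -⟩ | ⟨h₁, h₂⟩
  · have := ι.injective h₁
    simpa using this
  · have h₁ := ι.injective h₁
    have h₂ := ι.injective h₂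
    simp only [Prod.mk.injEq, Fin.ext_iff, Fin.val_castSucc, Fin.val_succ] at h₁ h₂
    omega

open Classical in
/-- A partition `loc` of the index set of the edges yields a partition of the edges, whatever the
permutations are. -/
theorem sum_map_layerEdge [Fintype X] [Fintype V] {K : Type} [Fintype K] (loc : X × Fin R → K) :
    ∑ j, (((Finset.univ.filter fun p => loc p = j).toList.map (layerEdge ι h) :
      List (V × V)) : Multiset (V × V)).map (fun e => s(e.1, e.2)) =
      (pathsGraph (layerEmb ι h)).edgeFinset.val := by
  let f : X × Fin R → Sym2 V := fun p => s((layerEdge ι h p).1, (layerEdge ι h p).2)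
  have h₁ : (pathsGraph (layerEmb ι h)).edgeFinset =
      Finset.univ.map ⟨f, layerEdge_sym2_injective ι h⟩ := by
    ext e
    rw [SimpleGraph.mem_edgeFinset, mem_edgeSet_pathsGraph_layerEmb]
    simp [f]
  have h₂ : ∀ s : Finset (X × Fin R), s.val.map f = ∑ p ∈ s, {f p} := fun s => by
    rw [← Multiset.sum_map_singleton (s.val.map f), Multiset.map_map]
    rfl
  have h₃ : ∀ j, (((Finset.univ.filter fun p => loc p = j).toList.map (layerEdge ι h) :
      List (V × V)) : Multiset (V × V)).map (fun e => s(e.1, e.2)) =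
      ∑ p with loc p = j, {f p} := fun j => by
    rw [← h₂, ← Multiset.map_coe, Finset.coe_toList, Multiset.map_map]
    rfl
  rw [h₁, Finset.map_val, Function.Embedding.coeFn_mk, h₂, Finset.sum_congr rfl fun j _ => h₃ j]
  exact Finset.sum_fiberwise _ _ _

end Paths

/-! ### Simulating many executions in parallel -/

section Simulation

variable {Θ : Type} {n q : ℕ}

/-- The darts of a graph on `n` nodes, all of whose degrees are two: the dart `(v, b)` leaves the
node `v` through its port `b`. -/
abbrev Dart (n : ℕ) : Type := Fin n × Bool

/-- The machines of the simulation.  The machine `Sum.inl (v, 0)` is responsible for the node `v`,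
and the machines `Sum.inl (v, a)` receive copies of its data.  The machine `Sum.inr ((s, t), j)`
plays the role of machine `j` in the execution that asks whether the dart `s` is mapped to the
dart `t`. -/
abbrev SimMachine (n q : ℕ) (K : Type) : Type :=
  (Fin n × (Fin 4 → Fin q)) ⊕ ((Dart n × Dart n) × K)

/-- The configuration in which the data of the node `v` are stored in all machines `Sum.inl (v, a)`
such that `a` vanishes from the index `ℓ` on, and all other memories are empty. -/
def spread [NeZero q] {K : Type} (ℓ : ℕ) (data : Θ → Fin n → List ℕ) :
    Θ → SimMachine n q K → List ℕ
  | θ, Sum.inl (v, a) => if ∀ m : Fin 4, ℓ ≤ m → a m = 0 then data θ v else []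
  | _, Sum.inr _ => []

theorem spread_zero_inl_zero [NeZero q] {K : Type} (data : Θ → Fin n → List ℕ) (θ : Θ) (v : Fin n) :
    spread (q := q) (K := K) 0 data θ (Sum.inl (v, 0)) = data θ v := by
  simp [spread]

theorem fits_spread [NeZero q] {K : Type} {S W : ℕ} (ℓ : ℕ) {data : Θ → Fin n → List ℕ}
    (hS : 4 ≤ S) (hlen : ∀ θ v, (data θ v).length ≤ 4) (hW : ∀ θ v, ∀ w ∈ data θ v, w < W) :
    Fits S W (spread (q := q) (K := K) ℓ data) := by
  rintro θ (⟨v, a⟩ | _)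
  · simp only [spread]
    split_ifs
    · exact ⟨(hlen θ v).trans hS, hW θ v⟩
    · simp
  · simp [spread]

theorem length_spread_le [NeZero q] {K : Type} (ℓ : ℕ) {data : Θ → Fin n → List ℕ}
    (hlen : ∀ θ v, (data θ v).length ≤ 4) (θ : Θ) (i : SimMachine n q K) :
    (spread ℓ data θ i).length ≤ 4 := by
  rcases i with ⟨v, a⟩ | _
  · simp only [spread]
    split_ifs
    · exact hlen θ v
    · simp
  · simp [spread]

/-- One level of the broadcast tree: the machine `Sum.inl (v, a)` sends its data to all machines
whose index differs from `a` only in the coordinate `ℓ`. -/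
theorem oneRound_spread [NeZero q] {K : Type} [Fintype K] {S W : ℕ} (ℓ : Fin 4)
    {data : Θ → Fin n → List ℕ} (hS : 4 * q ≤ S)
    (hlen : ∀ θ v, (data θ v).length ≤ 4) (hW : ∀ θ v, ∀ w ∈ data θ v, w < W) :
    OneRound S W (spread (q := q) (K := K) ℓ data) (spread (ℓ + 1) data) := by
  classical
  have hq : 1 ≤ q := NeZero.one_le
  refine OneRound.pull (fun j => match j with
    | Sum.inl (v, a) => {Sum.inl (v, Function.update a ℓ 0)}
    | Sum.inr _ => ∅) 4 (fits_spread ℓ (by omega) hlen hW)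
    (fun θ i _ _ => length_spread_le ℓ hlen θ i) ?_ ?_ ?_
  · rintro (⟨v, a⟩ | _)
    · simp only [Finset.card_singleton]
      omega
    · simp
  · rintro (⟨v, a⟩ | i)
    · refine ⟨(Finset.univ : Finset (Fin q)).image
        fun b => Sum.inl (v, Function.update a ℓ b), ?_, ?_⟩
      · rintro (⟨v', a'⟩ | _) hj
        · simp only [Finset.mem_singleton, Sum.inl.injEq, Prod.mk.injEq] at hj
          obtain ⟨rfl, rfl⟩ := hj
          simp only [Finset.mem_image, Finset.mem_univ, true_and]
          exact ⟨a' ℓ, by simp⟩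
        · simp at hj
      · refine le_trans (Nat.mul_le_mul_right 4 (m := q) ?_) (by omega)
        exact Finset.card_image_le.trans (by simp)
    · refine ⟨∅, ?_, by simp⟩
      rintro (⟨v', a'⟩ | _) <;> simp
  · rintro θ θ' (⟨v, a⟩ | _) - h
    · have h' := h (Sum.inl (v, Function.update a ℓ 0)) (by simp)
      simp only [spread] at h' ⊢
      by_cases ha : ∀ m : Fin 4, (ℓ : ℕ) + 1 ≤ m → a m = 0
      · have hup : ∀ m : Fin 4, (ℓ : ℕ) ≤ m → Function.update a ℓ 0 m = 0 := by
          intro m hm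
          by_cases hmℓ : m = ℓ
          · simp [hmℓ]
          · rw [Function.update_of_ne hmℓ]
            exact ha m (by have : (m : ℕ) ≠ ℓ := fun h => hmℓ (Fin.ext h); omega)
        simpa only [if_pos ha, if_pos hup] using h'
      · simp only [if_neg ha]
    · rfl

theorem computes_spread [NeZero q] {K : Type} [Fintype K] {S W : ℕ}
    {data : Θ → Fin n → List ℕ} (hS : 4 * q ≤ S)
    (hlen : ∀ θ v, (data θ v).length ≤ 4) (hW : ∀ θ v, ∀ w ∈ data θ v, w < W) :
    Computes S W 4 (spread (q := q) (K := K) 0 data) (spread 4 data) := by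
  have hq : 1 ≤ q := NeZero.one_le
  have hfit : ∀ ℓ, Fits S W (spread (q := q) (K := K) ℓ data) :=
    fun ℓ => fits_spread ℓ (by omega) hlen hW
  exact ((((Computes.refl (hfit 0)).step (oneRound_spread 0 hS hlen hW) (hfit 1)).step
    (oneRound_spread 1 hS hlen hW) (hfit 2)).step (oneRound_spread 2 hS hlen hW) (hfit 3)).step
    (oneRound_spread 3 hS hlen hW) (hfit 4)

/-- The initial configuration of an execution on the layered graph of the permutations `h`, whose
edges are distributed among the machines according to `loc`, with special nodes `(p.1, 0)` and
`(p.2, R)`. -/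
noncomputable def layerStart {X K : Type} [Fintype X] [DecidableEq K] {N R : ℕ}
    (ι : X × Fin (R + 1) ↪ Fin N) (loc : X × Fin R → K) (h : ℕ → Equiv.Perm X) (p : X × X) (j : K) :
    List ℕ :=
  [ι (p.1, 0), ι (p.2, Fin.last R)].map Fin.val ++
    ((Finset.univ.filter fun x => loc x = j).toList.map (layerEdge ι h)).flatMap
      fun e => [(e.1 : ℕ), (e.2 : ℕ)]

variable (A : MPCAlgorithm) (N : ℕ) (ω : A.Seed N)

/-- The configuration after `r` rounds of the simulated executions: `start θ p` is the initial
configuration of the execution with index `p`. -/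
def simConfig [NeZero q] (data : Θ → Fin n → List ℕ)
    (start : Θ → Dart n × Dart n → A.Machine N → List ℕ) (r : ℕ) :
    Θ → SimMachine n q (A.Machine N) → List ℕ
  | θ, Sum.inl i => spread (q := q) (K := A.Machine N) 0 data θ (Sum.inl i)
  | θ, Sum.inr (p, j) => A.mem N ω (start θ p) r j

theorem fits_simConfig [NeZero q] {S W S' W' : ℕ} {data : Θ → Fin n → List ℕ}
    {start : Θ → Dart n × Dart n → A.Machine N → List ℕ}
    (hS : 4 ≤ S) (hlen : ∀ θ v, (data θ v).length ≤ 4) (hW : ∀ θ v, ∀ w ∈ data θ v, w < W)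
    (hA : ∀ θ p, A.Respects N S' W' ω (start θ p)) (hSS : S' ≤ S) (hWW : W' ≤ W)
    {r : ℕ} (hr : r ≤ A.rounds N) : Fits S W (simConfig (q := q) A N ω data start r) := by
  rintro θ (i | ⟨p, j⟩)
  · exact fits_spread (q := q) (K := A.Machine N) 0 hS hlen hW θ (Sum.inl i)
  · obtain ⟨h₁, h₂⟩ := (hA θ p).1 r hr j
    exact ⟨h₁.trans hSS, fun w hw => (h₂ w hw).trans_le hWW⟩

/-- The simulated machines receive their edges from the machines that store copies of the data. -/
theorem oneRound_distribute [NeZero q] {S W R : ℕ} {data : Θ → Fin n → List ℕ}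
    [DecidableEq (A.Machine N)]
    (ι : Dart n × Fin (R + 1) ↪ Fin N) (loc : Dart n × Fin R → A.Machine N)
    (h : Θ → ℕ → Equiv.Perm (Dart n)) (e : Dart n × Dart n ↪ (Fin 4 → Fin q))
    (hS : 4 ≤ S) (hlen : ∀ θ v, (data θ v).length ≤ 4) (hW : ∀ θ v, ∀ w ∈ data θ v, w < W)
    (hR : 8 * R ≤ S) (hloc : ∀ j, (Finset.univ.filter fun x => loc x = j).card * 4 ≤ S)
    (hdata : ∀ θ θ' v, data θ v = data θ' v → ∀ b i, h θ i (v, b) = h θ' i (v, b)) :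
    OneRound S W (spread 4 data)
      (simConfig (q := q) A N ω data (fun θ => layerStart ι loc (h θ)) 0) := by
  classical
  have hspread : ∀ θ v (a : Fin 4 → Fin q),
      spread (K := A.Machine N) 4 data θ (Sum.inl (v, a)) = data θ v :=
    fun θ v a => by
      simp only [spread]
      exact if_pos fun m hm => absurd m.2 (by omega)
  refine OneRound.pull (fun j => match j with
    | Sum.inl _ => ∅
    | Sum.inr (p, j) => (Finset.univ.filter fun x => loc x = j).image
        fun x => Sum.inl (x.1.1, e p)) 4 (fits_spread 4 hS hlen hW)
    (fun θ i _ _ => length_spread_le 4 hlen θ i) ?_ ?_ ?_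
  · rintro (_ | ⟨p, j⟩)
    · simp
    · exact (Nat.mul_le_mul_right 4 Finset.card_image_le).trans (hloc j)
  · rintro (⟨v, a⟩ | i)
    · by_cases ha : ∃ p, e p = a
      · obtain ⟨p, rfl⟩ := ha
        refine ⟨(Finset.univ : Finset (Bool × Fin R)).image
          fun x => Sum.inr (p, loc ((v, x.1), x.2)), ?_, ?_⟩
        · rintro (_ | ⟨p', j⟩) hj
          · simp at hj
          · simp only [Finset.mem_filter, Finset.mem_univ, true_and, Finset.mem_image,
              Sum.inl.injEq, Prod.mk.injEq, EmbeddingLike.apply_eq_iff_eq] at hj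
            obtain ⟨⟨⟨v', b⟩, i⟩, rfl, rfl, rfl⟩ := hj
            simp only [Finset.mem_image, Finset.mem_univ, true_and]
            exact ⟨(b, i), rfl⟩
        · refine le_trans (Nat.mul_le_mul_right 4 (m := 2 * R) ?_) (by omega)
          exact Finset.card_image_le.trans (by simp)
      · refine ⟨∅, ?_, by simp⟩
        rintro (_ | ⟨p', j⟩)
        · simp
        · simp only [Finset.mem_image, Sum.inl.injEq, Prod.mk.injEq]
          rintro ⟨x, -, -, h⟩
          exact absurd ⟨p', h⟩ ha
    · refine ⟨∅, ?_, by simp⟩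
      rintro (_ | ⟨p', j⟩) <;> simp
  · rintro θ θ' (⟨v, a⟩ | ⟨p, j⟩) h₁ h₂
    · rw [hspread, hspread] at h₁
      simp only [simConfig, spread, h₁]
    · simp only [simConfig, MPCAlgorithm.mem, layerStart]
      congr 2
      refine List.map_congr_left fun x hx => ?_
      have := h₂ (Sum.inl (x.1.1, e p)) (Finset.mem_image_of_mem _ (Finset.mem_toList.1 hx))
      rw [hspread, hspread] at this
      have := hdata θ θ' _ this x.1.2 x.2
      simp only [Prod.mk.eta] at this
      simp only [layerEdge, this]

theorem oneRound_simConfig [NeZero q] {S W S' W' : ℕ} {data : Θ → Fin n → List ℕ}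
    {start : Θ → Dart n × Dart n → A.Machine N → List ℕ}
    (hA : ∀ θ p, A.Respects N S' W' ω (start θ p)) (hSS : S' ≤ S) (hWW : W' ≤ W)
    {r : ℕ} (hr : r < A.rounds N) :
    OneRound S W (simConfig (q := q) A N ω data start r) (simConfig A N ω data start (r + 1)) := by
  classical
  refine ⟨fun θ i i' => match i, i' with
    | Sum.inr (p, j), Sum.inr (p', j') => if p = p' then A.msg N ω (start θ p) r j j' else []
    | _, _ => [], ?_, ?_, ?_⟩
  · rintro θ θ' (i | ⟨p, j⟩) h <;> funext i'
    · rfl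
    · rcases i' with _ | ⟨p', j'⟩
      · rfl
      · simp only [simConfig] at h
        simp only [MPCAlgorithm.msg, h]
  · rintro θ θ' (i | ⟨p, j⟩) h₁ h₂
    · exact h₁
    · simp only [simConfig] at h₁
      simp only [simConfig, MPCAlgorithm.mem, h₁]
      congr 1
      funext j'
      simpa [MPCAlgorithm.msg] using h₂ (Sum.inr (p, j'))
  · rintro θ (i | ⟨p, j⟩)
    · refine ⟨by simp, ?_, by simp⟩
      rw [Fintype.sum_sum_type]
      simp
    · obtain ⟨h₁, h₂, h₃⟩ := (hA θ p).2 r hr j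
      refine ⟨?_, ?_, ?_⟩
      · rw [Fintype.sum_sum_type]
        simp only [List.length_nil, Finset.sum_const_zero, zero_add]
        rw [Fintype.sum_prod_type, Finset.sum_eq_single (a := p)]
        · simpa using h₁.trans hSS
        · intro p' _ hp
          simp [Ne.symm hp]
        · simp
      · rw [Fintype.sum_sum_type]
        simp only [List.length_nil, Finset.sum_const_zero, zero_add]
        rw [Fintype.sum_prod_type, Finset.sum_eq_single (a := p)]
        · simpa using h₂.trans hSS
        · intro p' _ hp
          simp [hp]
        · simp
      · rintro (_ | ⟨p', j'⟩) w hw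
        · simp at hw
        · simp only at hw
          split_ifs at hw
          · exact (h₃ j' w hw).trans_le hWW
          · simp at hw

/-- The executions that announce `true` inform the node machines; each of these hears from exactly
one execution for each of its two darts. -/
theorem oneRound_report [NeZero q] {S W : ℕ} {data data' : Θ → Fin n → List ℕ}
    {start : Θ → Dart n × Dart n → A.Machine N → List ℕ} {H : Θ → Dart n → Dart n}
    (hS : 4 ≤ S) (hWpos : 0 < W)
    (hout : ∀ θ s t, A.output N ω (start θ (s, t)) = true ↔ H θ s = t)
    (hdata' : ∀ θ θ' v, data θ v = data θ' v → (∀ b, H θ (v, b) = H θ' (v, b)) →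
      data' θ v = data' θ' v) :
    OneRound S W (simConfig (q := q) A N ω data start (A.rounds N)) (spread 0 data') := by
  classical
  refine ⟨fun θ i i' => match i, i' with
    | Sum.inr ((s, t), j), Sum.inl (v, a) =>
      if (j = A.outMachine N ∧ v = s.1 ∧ a = 0) ∧
        A.answer N ω (A.mem N ω (start θ (s, t)) (A.rounds N) j) = true then [0] else []
    | _, _ => [], ?_, ?_, ?_⟩
  · rintro θ θ' (i | ⟨p, j⟩) h <;> funext i'
    · rfl
    · rcases i' with ⟨v, a⟩ | _
      · simp only [simConfig] at h
        simp only [h]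
      · rfl
  · rintro θ θ' (⟨v, a⟩ | _) h₁ h₂
    · by_cases ha : a = 0
      · subst ha
        simp only [simConfig, spread_zero_inl_zero] at h₁ ⊢
        refine hdata' θ θ' v h₁ fun b => ?_
        have h := h₂ (Sum.inr (((v, b), H θ (v, b)), A.outMachine N))
        have hb : A.output N ω (start θ ((v, b), H θ (v, b))) = true := (hout _ _ _).2 rfl
        symm
        rw [← hout θ' (v, b) (H θ (v, b))]
        unfold MPCAlgorithm.output at hb ⊢
        by_contra hb'
        simp [hb, hb'] at h
      · have ha' : ¬ ∀ m : Fin 4, 0 ≤ (m : ℕ) → a m = 0 := fun h =>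
          ha (funext fun m => h m (Nat.zero_le _))
        simp only [spread, if_neg ha']
    · rfl
  · rintro θ (⟨v, a⟩ | ⟨⟨s, t⟩, j⟩)
    · refine ⟨by simp, ?_, by simp⟩
      refine sum_le_card_mul_of_support _ ((Finset.univ : Finset Bool).image fun b =>
        Sum.inr (((v, b), H θ (v, b)), A.outMachine N)) 1 S ?_ ?_ ?_
      · rintro (_ | ⟨⟨s, t⟩, j⟩) h
        · simp at h
        · obtain ⟨⟨rfl, rfl, -⟩, h'⟩ := of_length_ite_ne_zero h
          replace h' := (hout θ s t).1 h'
          simp only [Finset.mem_image, Finset.mem_univ, true_and]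
          exact ⟨s.2, by rw [Prod.mk.eta, h']⟩
      · rintro (_ | ⟨⟨s, t⟩, j⟩)
        · simp
        · simp only
          split_ifs <;> simp
      · have := (Finset.card_image_le (s := (Finset.univ : Finset Bool)) (f := fun b =>
          (Sum.inr (((v, b), H θ (v, b)), A.outMachine N) : SimMachine n q (A.Machine N))))
        simp only [Finset.card_univ, Fintype.card_bool] at this
        omega
    · refine ⟨?_, by simp, ?_⟩
      · refine sum_le_card_mul_of_support _ {Sum.inl (s.1, 0)} 1 S ?_ ?_ (by simp; omega)
        · rintro (⟨v, a⟩ | _) h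
          · obtain ⟨⟨-, rfl, rfl⟩, -⟩ := of_length_ite_ne_zero h
            simp
          · simp at h
        · rintro (⟨v, a⟩ | _)
          · simp only
            split_ifs <;> simp
          · simp
      · rintro (⟨v, a⟩ | _) w hw
        · simp only at hw
          split_ifs at hw
          · simp only [List.mem_singleton] at hw
            omega
          · simp at hw
        · simp at hw

/-- Broadcast, distribution, simulation and report: if the simulated executions decide whether
`H θ s = t`, then every node learns the values of `H θ` at its darts. -/
theorem computes_simulation [NeZero q] {S W S' W' R : ℕ} {data data' : Θ → Fin n → List ℕ}
    [DecidableEq (A.Machine N)]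
    (ι : Dart n × Fin (R + 1) ↪ Fin N) (loc : Dart n × Fin R → A.Machine N)
    (h : Θ → ℕ → Equiv.Perm (Dart n)) (e : Dart n × Dart n ↪ (Fin 4 → Fin q))
    {H : Θ → Dart n → Dart n} (hS : 4 * q ≤ S) (hWpos : 0 < W)
    (hlen : ∀ θ v, (data θ v).length ≤ 4) (hW : ∀ θ v, ∀ w ∈ data θ v, w < W)
    (hlen' : ∀ θ v, (data' θ v).length ≤ 4) (hW' : ∀ θ v, ∀ w ∈ data' θ v, w < W)
    (hR : 8 * R ≤ S) (hloc : ∀ j, (Finset.univ.filter fun x => loc x = j).card * 4 ≤ S)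
    (hdata : ∀ θ θ' v, data θ v = data θ' v → ∀ b i, h θ i (v, b) = h θ' i (v, b))
    (hA : ∀ θ p, A.Respects N S' W' ω (layerStart ι loc (h θ) p)) (hSS : S' ≤ S) (hWW : W' ≤ W)
    (hout : ∀ θ s t, A.output N ω (layerStart ι loc (h θ) (s, t)) = true ↔ H θ s = t)
    (hdata' : ∀ θ θ' v, data θ v = data θ' v → (∀ b, H θ (v, b) = H θ' (v, b)) →
      data' θ v = data' θ' v) :
    Computes S W (A.rounds N + 6)
      (spread (q := q) (K := A.Machine N) 0 data) (spread 0 data') := by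
  have hq : 1 ≤ q := NeZero.one_le
  have hS4 : 4 ≤ S := by omega
  have h₁ := (computes_spread (K := A.Machine N) hS hlen hW).step
    (oneRound_distribute A N ω ι loc h e hS4 hlen hW hR hloc hdata)
    (fits_simConfig A N ω hS4 hlen hW hA hSS hWW (Nat.zero_le _))
  have h₂ : ∀ r ≤ A.rounds N, Computes S W (5 + r) (spread (q := q) (K := A.Machine N) 0 data)
      (simConfig A N ω data (fun θ => layerStart ι loc (h θ)) r) := by
    intro r
    induction r with
    | zero => exact fun _ => h₁
    | succ r ih =>
      exact fun hr => (ih (by omega)).step (oneRound_simConfig A N ω hA hSS hWW hr)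
        (fits_simConfig A N ω hS4 hlen hW hA hSS hWW hr)
  have h₃ := (h₂ _ le_rfl).step (oneRound_report A N ω hS4 hWpos hout hdata')
    (fits_spread 0 hS4 hlen' hW')
  rwa [show 5 + A.rounds N + 1 = A.rounds N + 6 by omega] at h₃

end Simulation

/-! ### Path connectivity on layered graphs -/

section Layered

open Classical in
/-- Unfolding of `IsInputDistribution`, in whose definition the conversion of the special nodes to
words is elaborated as a monadic expression. -/
theorem isInputDistribution_iff {M : Type} [Fintype M] {n : ℕ} {G : SimpleGraph (Fin n)}
    {special : List (Fin n)} {start : M → List ℕ} :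
    IsInputDistribution G special start ↔ ∃ L : M → List (Fin n × Fin n),
      ∑ i, (L i : Multiset (Fin n × Fin n)).map (fun e => s(e.1, e.2)) = G.edgeFinset.val ∧
      ∀ i, start i = special.map Fin.val ++ (L i).flatMap (fun e => [(e.1 : ℕ), (e.2 : ℕ)]) := by
  have h : (do let v ← special; pure (v : ℕ)) = special.map Fin.val := by
    induction special <;> simp_all
  simp only [IsInputDistribution, h, List.map_id']

variable {X : Type} {N R : ℕ} (ι : X × Fin (R + 1) ↪ Fin N)

/-- The path-connectivity problem on a layered graph decides whether the product of the permutations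
maps `s` to `t`. -/
theorem pathConnectivity_inst_layered [DecidableEq X] {C : ℝ} {D : ℕ → ℕ} (hR : 1 ≤ R)
    (hRD : (R : ℝ) ≤ C * D N) (h : ℕ → Equiv.Perm X) (s t : X) :
    (pathConnectivity C D).inst N (pathsGraph (layerEmb ι h)) [ι (s, 0), ι (t, Fin.last R)]
      (decide (permProd h R s = t)) := by
  have hs : ι (s, 0) = layerEmb ι h (s, 0) := rfl
  have ht : ι (t, Fin.last R) = layerEmb ι h ((permProd h R).symm t, Fin.last R) := by
    exact congrArg (fun x => ι (x, Fin.last R)) ((permProd h R).apply_symm_apply t).symm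
  refine ⟨_, _, rfl, ?_, pathsGraph_isPathCollection _ hRD, ?_, ?_, ?_⟩
  · intro hst
    have := (Prod.ext_iff.1 (ι.injective hst)).2
    simp only [Fin.ext_iff, Fin.val_zero, Fin.val_last] at this
    omega
  · rw [hs]
    exact pathsGraph_ncard_neighborSet_zero _ hR s
  · rw [ht]
    exact pathsGraph_ncard_neighborSet_last _ hR _
  · rw [hs, ht, pathsGraph_reachable_iff, decide_eq_true_iff, Equiv.eq_symm_apply]

theorem length_flatMap_pair {α : Type*} (l : List α) (f g : α → ℕ) :
    (l.flatMap fun e => [f e, g e]).length = 2 * l.length := by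
  induction l with
  | nil => rfl
  | cons a l ih => simp [ih]; omega

theorem layerStart_length [Fintype X] {K : Type} [DecidableEq K] (loc : X × Fin R → K)
    (h : ℕ → Equiv.Perm X) (p : X × X) (j : K) :
    (layerStart ι loc h p j).length = 2 + 2 * (Finset.univ.filter fun x => loc x = j).card := by
  simp only [layerStart, List.length_append, length_flatMap_pair, List.length_map,
    Finset.length_toList, List.length_cons, List.length_nil]

theorem layerStart_isInputDistribution [Fintype X] {K : Type} [Fintype K] [DecidableEq K]
    (loc : X × Fin R → K) (h : ℕ → Equiv.Perm X) (s t : X) :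
    IsInputDistribution (pathsGraph (layerEmb ι h)) [ι (s, 0), ι (t, Fin.last R)]
      (layerStart ι loc h (s, t)) := by
  classical
  rw [isInputDistribution_iff]
  refine ⟨_, ?_, fun i => rfl⟩
  convert sum_map_layerEdge ι h loc

/-- As the input fits into the memories for one sequence of permutations, there is a partition of
the index set of the edges that respects the memories for every sequence of permutations. -/
theorem exists_loc [Fintype X] [Nonempty X] {K : Type} [Fintype K] [DecidableEq K] {S : ℕ}
    {special : List (Fin N)} (hspecial : special.length = 2)
    (hfit : ∃ start : K → List ℕ,
      IsInputDistribution (pathsGraph (layerEmb ι fun _ => 1)) special start ∧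
      ∀ i, (start i).length ≤ S) :
    ∃ loc : X × Fin R → K, ∀ j, 2 + 2 * (Finset.univ.filter fun x => loc x = j).card ≤ S := by
  classical
  obtain ⟨start, hstart, hS⟩ := hfit
  obtain ⟨L, hL, hstart⟩ := isInputDistribution_iff.1 hstart
  let f : X × Fin R → Sym2 (Fin N) :=
    fun p => s((layerEdge ι (fun _ => 1) p).1, (layerEdge ι (fun _ => 1) p).2)
  have hloc : ∀ p, ∃ j, f p ∈ (L j).map fun e => s(e.1, e.2) := by
    intro p
    have hp : f p ∈ (pathsGraph (layerEmb ι fun _ => 1)).edgeFinset.val := by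
      rw [Finset.mem_val, SimpleGraph.mem_edgeFinset, mem_edgeSet_pathsGraph_layerEmb]
      exact ⟨p, rfl⟩
    have hp' : f p ∈ ∑ i, (L i : Multiset (Fin N × Fin N)).map (fun e => s(e.1, e.2)) := by
      convert hp
    obtain ⟨j, -, hj⟩ := Multiset.mem_sum.1 hp'
    exact ⟨j, by simpa using hj⟩
  choose loc hloc using hloc
  refine ⟨loc, fun j => ?_⟩
  have hcard : (Finset.univ.filter fun x => loc x = j).card ≤ (L j).length := by
    rw [← Finset.card_image_of_injective _ (layerEdge_sym2_injective ι fun _ => 1),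
      ← List.length_map (f := fun e : Fin N × Fin N => s(e.1, e.2)) (as := L j)]
    refine le_trans (Finset.card_le_card ?_) (List.toFinset_card_le _)
    intro e he
    obtain ⟨p, hp, rfl⟩ := Finset.mem_image.1 he
    rw [List.mem_toFinset]
    obtain rfl := (Finset.mem_filter.1 hp).2
    exact hloc p
  have := hS j
  rw [hstart, List.length_append, List.length_map, hspecial, length_flatMap_pair] at this
  omega

/-- An algorithm for path connectivity computes products of permutations, from initial
configurations in which every edge of the layered graph has a fixed location. -/
theorem exists_loc_forall_perm [Fintype X] [Nonempty X] [DecidableEq X] {C δ : ℝ} {D : ℕ → ℕ}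
    {b : ℕ} (A : MPCAlgorithm) [DecidableEq (A.Machine N)] (hR : 1 ≤ R) (hRD : (R : ℝ) ≤ C * D N)
    (hA : ∀ (G : SimpleGraph (Fin N)) (special : List (Fin N)) (ans : Bool),
      (pathConnectivity C D).inst N G special ans →
      (∃ start : A.Machine N → List ℕ, IsInputDistribution G special start ∧
        ∀ i, (start i).length ≤ localMemory δ N) ∧
      ∀ start : A.Machine N → List ℕ, IsInputDistribution G special start →
        (∀ i, (start i).length ≤ localMemory δ N) →
        ∀ ω, ω ∈ {ω | A.Succeeds δ b N start ans ω}) :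
    ∃ loc : X × Fin R → A.Machine N,
      (∀ j, 2 + 2 * (Finset.univ.filter fun x => loc x = j).card ≤ localMemory δ N) ∧
      ∀ ω (h : ℕ → Equiv.Perm X) (s t : X),
        A.Respects N (localMemory δ N) (N ^ b) ω (layerStart ι loc h (s, t)) ∧
        (A.output N ω (layerStart ι loc h (s, t)) = true ↔ permProd h R s = t) := by
  obtain ⟨x⟩ := ‹Nonempty X›
  obtain ⟨loc, hloc⟩ := exists_loc (X := X) ι (by rfl)
    (hA _ _ _ (pathConnectivity_inst_layered ι hR hRD (fun _ => 1) x x)).1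
  refine ⟨loc, hloc, fun ω h s t => ?_⟩
  have := (hA _ _ _ (pathConnectivity_inst_layered ι hR hRD h s t)).2 _
    (layerStart_isInputDistribution ι loc h s t)
    (fun i => by rw [layerStart_length]; exact hloc i) ω
  exact ⟨this.1, by rw [this.2, decide_eq_true_iff]⟩

end Layered

/-! ### Powers of a permutation by Horner's rule -/

section Powers

/-- The factors of the product `σ ^ d * g ^ r`, followed by trivial factors. -/
def hornerSeq {X : Type} (r d : ℕ) (σ g : Equiv.Perm X) (i : ℕ) : Equiv.Perm X :=
  if i < r then g else if i < r + d then σ else 1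

theorem permProd_hornerSeq {X : Type} {r d : ℕ} (hd : d ≤ r) (σ g : Equiv.Perm X) :
    permProd (hornerSeq r d σ g) (2 * r) = σ ^ d * g ^ r := by
  have h₁ : ∀ i ≤ r, permProd (hornerSeq r d σ g) i = g ^ i := by
    intro i
    induction i with
    | zero => exact fun _ => rfl
    | succ i ih =>
      intro hi
      rw [permProd, ih (by omega), hornerSeq, if_pos (by omega), pow_succ']
  have h₂ : ∀ i ≤ d, permProd (hornerSeq r d σ g) (r + i) = σ ^ i * g ^ r := by
    intro i
    induction i with
    | zero => exact fun _ => by rw [add_zero, h₁ r le_rfl, pow_zero, one_mul]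
    | succ i ih =>
      intro hi
      rw [← add_assoc, permProd, ih (by omega), hornerSeq, if_neg (by omega), if_pos (by omega),
        pow_succ', mul_assoc]
  have h₃ : ∀ i, permProd (hornerSeq r d σ g) (r + d + i) = σ ^ d * g ^ r := by
    intro i
    induction i with
    | zero => exact h₂ d le_rfl
    | succ i ih =>
      rw [← add_assoc, permProd, ih, hornerSeq, if_neg (by omega), if_neg (by omega), one_mul]
  rw [← h₃ (r - d)]
  congr 1
  omega

/-- The word that names a dart. -/
def dartCode {n : ℕ} (x : Dart n) : ℕ := 2 * x.1 + x.2.toNat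

theorem dartCode_injective {n : ℕ} : Function.Injective (dartCode (n := n)) := by
  rintro ⟨v, b⟩ ⟨w, c⟩ h
  have hb := b.toNat_lt
  have hc := c.toNat_lt
  simp only [dartCode] at h
  have h₁ : (v : ℕ) = w := by omega
  have h₂ : b.toNat = c.toNat := by omega
  rw [Prod.mk.injEq]
  refine ⟨Fin.ext h₁, ?_⟩
  cases b <;> cases c <;> simp_all

theorem dartCode_lt {n : ℕ} (x : Dart n) : dartCode x < 2 * n := by
  have := x.2.toNat_lt
  have := x.1.2
  simp only [dartCode]
  omega

/-- The data stored for the node `v`: the values of two permutations at its darts. -/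
def nodeData {n : ℕ} (σ g : Equiv.Perm (Dart n)) (v : Fin n) : List ℕ :=
  [dartCode (σ (v, false)), dartCode (σ (v, true)), dartCode (g (v, false)),
    dartCode (g (v, true))]

theorem nodeData_eq_iff {n : ℕ} {σ g σ' g' : Equiv.Perm (Dart n)} {v : Fin n} :
    nodeData σ g v = nodeData σ' g' v ↔
      (∀ b, σ (v, b) = σ' (v, b)) ∧ ∀ b, g (v, b) = g' (v, b) := by
  simp only [nodeData, List.cons.injEq, dartCode_injective.eq_iff, Bool.forall_bool, and_true,
    and_assoc]

theorem nodeData_lt {n W : ℕ} (hW : 2 * n ≤ W) (σ g : Equiv.Perm (Dart n)) (v : Fin n) :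
    ∀ w ∈ nodeData σ g v, w < W := by
  intro w hw
  simp only [nodeData, List.mem_cons, List.not_mem_nil, or_false] at hw
  rcases hw with rfl | rfl | rfl | rfl <;> exact (dartCode_lt _).trans_le hW

variable {Θ : Type} {n q N : ℕ} (A : MPCAlgorithm)

/-- `J` applications of a path-connectivity algorithm to layered graphs with `2 * r` layers of edges
compute `σ ^ k`, for every `k < r ^ J`. -/
theorem computes_pow [NeZero q] [NeZero n] {C δ : ℝ} {D : ℕ → ℕ} {b r S W : ℕ}
    (hr : 1 ≤ r) (hrD : ((2 * r : ℕ) : ℝ) ≤ C * D N)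
    (hA : ∀ (G : SimpleGraph (Fin N)) (special : List (Fin N)) (ans : Bool),
      (pathConnectivity C D).inst N G special ans →
      (∃ start : A.Machine N → List ℕ, IsInputDistribution G special start ∧
        ∀ i, (start i).length ≤ localMemory δ N) ∧
      ∀ start : A.Machine N → List ℕ, IsInputDistribution G special start →
        (∀ i, (start i).length ≤ localMemory δ N) →
        ∀ ω, ω ∈ {ω | A.Succeeds δ b N start ans ω})
    (hN : 2 * n * (2 * r + 1) ≤ N) (hqn : 2 * n ≤ q ^ 2) (hS : 4 * q ≤ S) (hrS : 16 * r ≤ S)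
    (hAS : 2 * localMemory δ N ≤ S) (hnW : 2 * n ≤ W) (hAW : N ^ b ≤ W)
    (σ : Θ → Equiv.Perm (Dart n)) (J k : ℕ) (hk : k < r ^ J) :
    Computes S W (J * (A.rounds N + 6))
      (spread (q := q) (K := A.Machine N) 0 fun θ => nodeData (σ θ) 1)
      (spread 0 fun θ => nodeData (σ θ) (σ θ ^ k)) := by
  classical
  have hq : 1 ≤ q := NeZero.one_le
  have hn : 1 ≤ n := NeZero.one_le
  obtain ⟨ι⟩ : Nonempty (Dart n × Fin (2 * r + 1) ↪ Fin N) := by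
    refine Function.Embedding.nonempty_of_card_le ?_
    simp only [Fintype.card_prod, Fintype.card_fin, Fintype.card_bool]
    rwa [mul_comm n 2]
  obtain ⟨e⟩ : Nonempty (Dart n × Dart n ↪ (Fin 4 → Fin q)) := by
    refine Function.Embedding.nonempty_of_card_le ?_
    simp only [Fintype.card_prod, Fintype.card_fin, Fintype.card_bool, Fintype.card_pi,
      Finset.prod_const, Finset.card_univ]
    calc n * 2 * (n * 2) = (2 * n) * (2 * n) := by ring
      _ ≤ q ^ 2 * q ^ 2 := Nat.mul_le_mul hqn hqn
      _ = q ^ 4 := by ring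
  obtain ⟨loc, hloc, hrun⟩ := exists_loc_forall_perm ι A (by omega) hrD hA
  have ω : A.Seed N := Classical.arbitrary _
  have hlen : ∀ (g : Θ → Equiv.Perm (Dart n)) θ v, (nodeData (σ θ) (g θ) v).length ≤ 4 :=
    fun _ _ _ => le_rfl
  have hlt : ∀ (g : Θ → Equiv.Perm (Dart n)) θ v, ∀ w ∈ nodeData (σ θ) (g θ) v, w < W :=
    fun _ _ v => nodeData_lt hnW _ _ v
  -- one step of Horner's rule
  have stage : ∀ (d : ℕ) (g : Θ → Equiv.Perm (Dart n)), d ≤ r →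
      Computes S W (A.rounds N + 6)
        (spread (q := q) (K := A.Machine N) 0 fun θ => nodeData (σ θ) (g θ))
        (spread 0 fun θ => nodeData (σ θ) (σ θ ^ d * g θ ^ r)) := by
    intro d g hd
    refine computes_simulation A N ω ι loc (fun θ => hornerSeq r d (σ θ) (g θ)) e
      (H := fun θ => ⇑(σ θ ^ d * g θ ^ r))
      hS (by omega) (hlen _) (hlt _) (hlen _) (hlt _) (by omega)
      (fun j => by have := hloc j; omega) ?_
      (fun θ p => (hrun ω _ p.1 p.2).1) (by omega) hAW ?_ ?_
    · intro θ θ' v h b i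
      obtain ⟨h₁, h₂⟩ := nodeData_eq_iff.1 h
      simp only [hornerSeq]
      split_ifs
      · exact h₂ b
      · exact h₁ b
      · rfl
    · intro θ s t
      rw [(hrun ω _ s t).2, permProd_hornerSeq hd]
    · intro θ θ' v h h'
      exact nodeData_eq_iff.2 ⟨(nodeData_eq_iff.1 h).1, h'⟩
  induction J generalizing k with
  | zero =>
    obtain rfl : k = 0 := by simpa using hk
    simpa using Computes.refl (fits_spread 0 (by omega) (hlen _) (hlt _))
  | succ J ih =>
    have h := (ih (k / r) (by rwa [Nat.div_lt_iff_lt_mul hr, ← pow_succ])).trans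
      (stage (k % r) _ (Nat.mod_lt k hr).le)
    have hpow : ∀ θ, σ θ ^ (k % r) * (σ θ ^ (k / r)) ^ r = σ θ ^ k := by
      intro θ
      rw [← pow_mul, ← pow_add, mul_comm (k / r), Nat.mod_add_div]
    simp only [hpow] at h
    rwa [Nat.succ_mul]

end Powers

/-! ### Traversing a graph all of whose degrees are two -/

section Traversal

variable {n : ℕ}

open Classical in
/-- The ports of a node with the set `s` of neighbors: an enumeration of `s`, if `s` has two
elements, and a junk value otherwise.  It depends on `s` only, so that a machine that knows `s` can
compute it. -/
noncomputable def port [NeZero n] (s : Set (Fin n)) : Bool → Fin n :=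
  if h : ∃ f : Bool → Fin n, Function.Injective f ∧ Set.range f = s then h.choose else fun _ => 0

theorem port_spec [NeZero n] {s : Set (Fin n)} (hs : s.ncard = 2) :
    Function.Injective (port s) ∧ Set.range (port s) = s := by
  have h : ∃ f : Bool → Fin n, Function.Injective f ∧ Set.range f = s := by
    obtain ⟨u, v, huv, rfl⟩ := Set.ncard_eq_two.1 hs
    refine ⟨fun b => bif b then u else v, ?_, ?_⟩
    · intro a b h
      cases a <;> cases b <;> simp_all [eq_comm]
    · ext w
      simp [or_comm, eq_comm]
  rw [port, dif_pos h]
  exact h.choose_spec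

theorem exists_port_eq [NeZero n] {G : SimpleGraph (Fin n)} (hG : ∀ v, (G.neighborSet v).ncard = 2)
    {v w : Fin n} : (∃ b, port (G.neighborSet v) b = w) ↔ G.Adj v w := by
  rw [← SimpleGraph.mem_neighborSet]
  exact Set.ext_iff.1 (port_spec (hG v)).2 w

/-- The non-backtracking step: follow a dart and leave the node reached through its other port. -/
noncomputable def dartStep [NeZero n] (G : SimpleGraph (Fin n)) (x : Dart n) : Dart n :=
  (port (G.neighborSet x.1) x.2,
    decide (port (G.neighborSet (port (G.neighborSet x.1) x.2)) false = x.1))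

theorem adj_dartStep [NeZero n] {G : SimpleGraph (Fin n)} (hG : ∀ v, (G.neighborSet v).ncard = 2)
    (x : Dart n) : G.Adj x.1 (dartStep G x).1 :=
  (exists_port_eq hG).1 ⟨x.2, rfl⟩

theorem port_not_dartStep [NeZero n] {G : SimpleGraph (Fin n)}
    (hG : ∀ v, (G.neighborSet v).ncard = 2) (x : Dart n) :
    port (G.neighborSet (dartStep G x).1) (!(dartStep G x).2) = x.1 := by
  obtain ⟨b, hb⟩ := (exists_port_eq hG).2 (adj_dartStep hG x).symm
  by_cases h : port (G.neighborSet (dartStep G x).1) false = x.1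
  · have h' : (dartStep G x).2 = true := decide_eq_true h
    rwa [h']
  · have h' : (dartStep G x).2 = false := decide_eq_false h
    rw [h']
    cases b
    · exact absurd hb h
    · exact hb

theorem dartStep_injective [NeZero n] {G : SimpleGraph (Fin n)}
    (hG : ∀ v, (G.neighborSet v).ncard = 2) : Function.Injective (dartStep G) := by
  intro x y h
  have h₁ : x.1 = y.1 := by rw [← port_not_dartStep hG x, h, port_not_dartStep hG y]
  refine Prod.ext h₁ ((port_spec (hG x.1)).1 ?_)
  have := (Prod.ext_iff.1 h).1
  simp only [dartStep] at this
  rw [this, h₁]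

/-- The non-backtracking step as a permutation of the darts. -/
noncomputable def dartPerm [NeZero n] (G : SimpleGraph (Fin n))
    (hG : ∀ v, (G.neighborSet v).ncard = 2) : Equiv.Perm (Dart n) :=
  Equiv.ofBijective (dartStep G) (Finite.injective_iff_bijective.1 (dartStep_injective hG))

theorem dartStep_dartStep_ne [NeZero n] {G : SimpleGraph (Fin n)}
    (hG : ∀ v, (G.neighborSet v).ncard = 2) (x : Dart n) :
    (dartStep G (dartStep G x)).1 ≠ x.1 := by
  intro h
  rw [← port_not_dartStep hG x] at h
  have := (port_spec (hG _)).1 h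
  simp at this

/-- The nodes visited by a traversal form a non-backtracking walk. -/
theorem dartPerm_pow_walk [NeZero n] {G : SimpleGraph (Fin n)}
    (hG : ∀ v, (G.neighborSet v).ncard = 2) (x : Dart n) (j : ℕ) :
    G.Adj ((dartPerm G hG ^ j) x).1 ((dartPerm G hG ^ (j + 1)) x).1 ∧
      ((dartPerm G hG ^ (j + 2)) x).1 ≠ ((dartPerm G hG ^ j) x).1 := by
  simp only [pow_succ', Equiv.Perm.mul_apply]
  exact ⟨adj_dartStep hG _, dartStep_dartStep_ne hG _⟩

theorem cycleGraph_adj_iff {m : ℕ} [NeZero m] (hm : 3 ≤ m) {u v : Fin m} :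
    (SimpleGraph.cycleGraph m).Adj u v ↔ v = u + 1 ∨ v = u - 1 := by
  obtain ⟨m, rfl⟩ : ∃ m', m = m' + 2 := ⟨m - 2, by omega⟩
  rw [SimpleGraph.cycleGraph_adj, sub_eq_iff_eq_add, sub_eq_iff_eq_add, or_comm,
    eq_sub_iff_add_eq, add_comm 1, add_comm 1, eq_comm (a := u)]

open Fin.CommRing in
/-- A non-backtracking walk of length `k` on a cycle of length `m` ends where it started if and only
if `m` divides `k`. -/
theorem nonbacktracking_cycleGraph {m : ℕ} [NeZero m] (hm : 3 ≤ m) (a : ℕ → Fin m)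
    (hadj : ∀ j, (SimpleGraph.cycleGraph m).Adj (a j) (a (j + 1))) (hne : ∀ j, a (j + 2) ≠ a j)
    (k : ℕ) : a k = a 0 ↔ m ∣ k := by
  -- the walk keeps the direction `ε` of its first step
  have key : ∀ ε : Fin m, ε = 1 ∨ ε = -1 → a 1 = a 0 + ε →
      ∀ j, a j = a 0 + j * ε ∧ a (j + 1) = a 0 + (j + 1 : ℕ) * ε := by
    intro ε hε h1 j
    induction j with
    | zero => simpa using h1
    | succ j ih =>
      refine ⟨ih.2, ?_⟩
      have h := (cycleGraph_adj_iff hm).1 (hadj (j + 1))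
      have hn := hne j
      rw [ih.1] at hn
      rw [ih.2] at h
      push_cast at h ⊢
      rcases hε with rfl | rfl
      · rcases h with h | h
        · rw [h]; ring
        · exact absurd (by rw [h]; ring) hn
      · rcases h with h | h
        · exact absurd (by rw [h]; ring) hn
        · rw [h]; ring
  obtain ⟨ε, hε, h1⟩ : ∃ ε : Fin m, (ε = 1 ∨ ε = -1) ∧ a 1 = a 0 + ε := by
    rcases (cycleGraph_adj_iff hm).1 (hadj 0) with h | h
    · exact ⟨1, Or.inl rfl, h⟩
    · exact ⟨-1, Or.inr rfl, by rw [h, sub_eq_add_neg]⟩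
  rw [(key ε hε h1 k).1, add_eq_left, ← Fin.natCast_eq_zero]
  rcases hε with rfl | rfl <;> simp

/-- A cycle on `2 * k` nodes and two cycles on `k` nodes are told apart by the traversal of
length `k`. -/
theorem dartPerm_pow_eq_iff {k : ℕ} (hk : 3 ≤ k) {G : SimpleGraph (Fin n)} [NeZero n]
    (hnk : n = 2 * k) {ans : Bool}
    (hans : (ans = true ∧ Nonempty (G ≃g SimpleGraph.cycleGraph n)) ∨
      (ans = false ∧ Nonempty (G ≃g (SimpleGraph.cycleGraph k ⊕g SimpleGraph.cycleGraph k))))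
    (hG : ∀ v, (G.neighborSet v).ncard = 2) (x : Dart n) :
    ((dartPerm G hG ^ k) x).1 = x.1 ↔ ans = false := by
  have hw := dartPerm_pow_walk hG x
  set a : ℕ → Fin n := fun j => ((dartPerm G hG ^ j) x).1 with ha
  have hx : x.1 = a 0 := by simp [ha]
  rw [hx]
  change a k = a 0 ↔ _
  rcases hans with ⟨rfl, ⟨φ⟩⟩ | ⟨rfl, ⟨φ⟩⟩
  · have h := nonbacktracking_cycleGraph (by omega) (fun j => φ (a j))
      (fun j => φ.map_adj_iff.2 (hw j).1) (fun j h => (hw j).2 (φ.injective h)) k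
    rw [← φ.injective.eq_iff, h]
    simp only [Bool.true_eq_false, iff_false]
    exact fun h => by have := Nat.le_of_dvd (by omega) h; omega
  · have : NeZero k := ⟨by omega⟩
    suffices h : φ (a k) = φ (a 0) by simpa using φ.injective h
    have hadj : ∀ j, (SimpleGraph.cycleGraph k ⊕g SimpleGraph.cycleGraph k).Adj
      (φ (a j)) (φ (a (j + 1))) := fun j => φ.map_adj_iff.2 (hw j).1
    have hne : ∀ j, φ (a (j + 2)) ≠ φ (a j) := fun j h => (hw j).2 (φ.injective h)
    -- the walk stays in the cycle in which it starts
    rcases h0 : φ (a 0) with u | u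
    · have h : ∀ j, ∃ w, φ (a j) = Sum.inl w := by
        intro j
        induction j with
        | zero => exact ⟨u, h0⟩
        | succ j ih =>
          obtain ⟨w, hw⟩ := ih
          have := hadj j
          rw [hw] at this
          rcases h : φ (a (j + 1)) with w' | w'
          · exact ⟨w', rfl⟩
          · simp [h] at this
      choose w hw using h
      simp only [hw, SimpleGraph.sum_adj, ne_eq, Sum.inl.injEq] at hadj hne h0 ⊢
      rw [← h0]
      exact (nonbacktracking_cycleGraph hk w hadj hne k).2 dvd_rfl
    · have h : ∀ j, ∃ w, φ (a j) = Sum.inr w := by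
        intro j
        induction j with
        | zero => exact ⟨u, h0⟩
        | succ j ih =>
          obtain ⟨w, hw⟩ := ih
          have := hadj j
          rw [hw] at this
          rcases h : φ (a (j + 1)) with w' | w'
          · simp [h] at this
          · exact ⟨w', rfl⟩
      choose w hw using h
      simp only [hw, SimpleGraph.sum_adj, ne_eq, Sum.inr.injEq] at hadj hne h0 ⊢
      rw [← h0]
      exact (nonbacktracking_cycleGraph hk w hadj hne k).2 dvd_rfl

theorem ncard_neighborSet_cycleGraph {m : ℕ} (hm : 3 ≤ m) (v : Fin m) :
    ((SimpleGraph.cycleGraph m).neighborSet v).ncard = 2 := by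
  have : NeZero m := ⟨by omega⟩
  have h : (SimpleGraph.cycleGraph m).neighborSet v = {v - 1, v + 1} := by
    ext w
    rw [SimpleGraph.mem_neighborSet, cycleGraph_adj_iff hm, or_comm]
    rfl
  rw [h, Set.ncard_pair]
  intro h
  -- otherwise `2 = 0` in `Fin m`
  have h2 : (1 : Fin m) + 1 = 0 := by
    have := sub_eq_iff_eq_add.1 h
    rwa [add_assoc, left_eq_add] at this
  have := congrArg Fin.val h2
  rw [Fin.val_add, Fin.val_one', Fin.val_zero, Nat.mod_eq_of_lt (by omega : 1 < m),
    Nat.mod_eq_of_lt (by omega)] at this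
  omega

theorem ncard_neighborSet_iso {V V' : Type} {G : SimpleGraph V} {G' : SimpleGraph V'} (φ : G ≃g G')
    (v : V) : (G.neighborSet v).ncard = (G'.neighborSet (φ v)).ncard := by
  rw [← Nat.card_coe_set_eq, ← Nat.card_coe_set_eq]
  exact Nat.card_congr (φ.mapNeighborSet v)

theorem ncard_neighborSet_of_oneVsTwoCycles {G : SimpleGraph (Fin n)} {special : List (Fin n)}
    {ans : Bool} (h : oneVsTwoCycles.inst n G special ans) (v : Fin n) :
    (G.neighborSet v).ncard = 2 := by
  obtain ⟨-, k, hk, hn, ⟨-, ⟨φ⟩⟩ | ⟨-, ⟨φ⟩⟩⟩ := h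
  · rw [ncard_neighborSet_iso φ]
    exact ncard_neighborSet_cycleGraph (by omega) _
  · rw [ncard_neighborSet_iso φ]
    rcases φ v with w | w
    · have h : (SimpleGraph.cycleGraph k ⊕g SimpleGraph.cycleGraph k).neighborSet (Sum.inl w) =
          Sum.inl '' (SimpleGraph.cycleGraph k).neighborSet w := by
        ext (u | u) <;> simp
      rw [h, Set.ncard_image_of_injective _ Sum.inl_injective, ncard_neighborSet_cycleGraph hk]
    · have h : (SimpleGraph.cycleGraph k ⊕g SimpleGraph.cycleGraph k).neighborSet (Sum.inr w) =
          Sum.inr '' (SimpleGraph.cycleGraph k).neighborSet w := by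
        ext (u | u) <;> simp
      rw [h, Set.ncard_image_of_injective _ Sum.inr_injective, ncard_neighborSet_cycleGraph hk]

end Traversal

/-! ### From the distributed edges to the permutation of the darts -/

section Preprocessing

variable {n q : ℕ} {K : Type}

/-- The possible initial configurations of machines with `S` words of memory: a graph all of whose
degrees are two, and a distribution of its edges. -/
structure RegularInput (n : ℕ) (M : Type) [Fintype M] (S : ℕ) where
  /-- the graph -/
  graph : SimpleGraph (Fin n)
  /-- the initial memory contents -/
  start : M → List ℕ
  ncard_neighborSet : ∀ v, (graph.neighborSet v).ncard = 2
  isInputDistribution : IsInputDistribution graph [] start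
  length_start_le : ∀ i, (start i).length ≤ S

namespace RegularInput

variable {M : Type} [Fintype M] {S : ℕ} (θ : RegularInput n M S)

theorem exists_edges : ∃ L : M → List (Fin n × Fin n),
    (∑ i, (L i : Multiset (Fin n × Fin n)).map (fun e => s(e.1, e.2)) =
      (θ.graph.edgeSet.toFinite.toFinset).val) ∧
    ∀ i, θ.start i = (L i).flatMap (fun e => [(e.1 : ℕ), (e.2 : ℕ)]) := by
  obtain ⟨L, hL, hs⟩ := isInputDistribution_iff.1 θ.isInputDistribution
  refine ⟨L, ?_, by simpa using hs⟩
  rw [hL]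
  congr 1
  ext e
  simp

/-- The edges held by each machine. -/
noncomputable def edges : M → List (Fin n × Fin n) := θ.exists_edges.choose

theorem sum_map_edges : ∑ i, (θ.edges i : Multiset (Fin n × Fin n)).map (fun e => s(e.1, e.2)) =
    (θ.graph.edgeSet.toFinite.toFinset).val := θ.exists_edges.choose_spec.1

theorem start_eq (i : M) : θ.start i = (θ.edges i).flatMap (fun e => [(e.1 : ℕ), (e.2 : ℕ)]) :=
  θ.exists_edges.choose_spec.2 i

theorem flatMap_pair_injective : Function.Injective fun l : List (Fin n × Fin n) =>
    l.flatMap (fun e => [(e.1 : ℕ), (e.2 : ℕ)]) := by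
  intro l
  induction l with
  | nil =>
    rintro (_ | ⟨e, l'⟩) h
    · rfl
    · simp at h
  | cons e l ih =>
    rintro (_ | ⟨e', l'⟩) h
    · simp at h
    · simp only [List.flatMap_cons, List.cons_append, List.nil_append, List.cons.injEq] at h
      rw [ih h.2.2, Prod.ext (Fin.ext h.1) (Fin.ext h.2.1)]

theorem edges_eq_of_start_eq {θ θ' : RegularInput n M S} {i : M} (h : θ.start i = θ'.start i) :
    θ.edges i = θ'.edges i := by
  rw [start_eq, start_eq] at h
  exact flatMap_pair_injective h

end RegularInput

/-- The neighbors of `v` along the edges in the list `l`, as words. -/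
def neighborWords (l : List (Fin n × Fin n)) (v : Fin n) : List ℕ :=
  l.flatMap fun e => (if e.1 = v then [(e.2 : ℕ)] else []) ++ if e.2 = v then [(e.1 : ℕ)] else []

theorem mem_neighborWords {l : List (Fin n × Fin n)} {v u : Fin n} :
    (u : ℕ) ∈ neighborWords l v ↔ ∃ e ∈ l, s(e.1, e.2) = s(v, u) := by
  simp only [neighborWords, List.mem_flatMap, List.mem_append, Sym2.eq_iff]
  refine exists_congr fun e => and_congr_right fun _ => or_congr ?_ ?_
  · split_ifs with h <;> simp [h, Fin.ext_iff, eq_comm]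
  · split_ifs with h <;> simp [h, Fin.ext_iff, eq_comm]

theorem neighborWords_lt {l : List (Fin n × Fin n)} {v : Fin n} :
    ∀ w ∈ neighborWords l v, w < n := by
  intro w hw
  simp only [neighborWords, List.mem_flatMap, List.mem_append] at hw
  obtain ⟨e, -, h | h⟩ := hw <;> split_ifs at h <;> simp at h <;> omega

/-- A machine sends two words per edge in the first round, as many as it held. -/
theorem sum_length_neighborWords (l : List (Fin n × Fin n)) :
    ∑ v, (neighborWords l v).length = 2 * l.length := by
  induction l with
  | nil => simp [neighborWords]
  | cons e l ih =>
    have h : ∀ v, (neighborWords (e :: l) v).length =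
        ((if e.1 = v then 1 else 0) + if e.2 = v then 1 else 0) + (neighborWords l v).length := by
      intro v
      simp only [neighborWords, List.flatMap_cons, List.length_append]
      congr 2 <;> split_ifs <;> rfl
    simp only [h, Finset.sum_add_distrib, Finset.sum_ite_eq, Finset.mem_univ, if_true, ih,
      List.length_cons]
    omega

/-- The number of ends of an edge (a loop has two) that are equal to `v`. -/
def endCount (v : Fin n) : Sym2 (Fin n) → ℕ :=
  Sym2.lift ⟨fun a b => (if a = v then 1 else 0) + if b = v then 1 else 0, fun _ _ => add_comm _ _⟩

theorem length_neighborWords (l : List (Fin n × Fin n)) (v : Fin n) :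
    (neighborWords l v).length =
      (((l : Multiset (Fin n × Fin n)).map fun e => s(e.1, e.2)).map (endCount v)).sum := by
  induction l with
  | nil => rfl
  | cons e l ih =>
    simp only [Multiset.map_coe, Multiset.sum_coe, List.map_cons, List.sum_cons] at ih ⊢
    rw [← ih]
    simp only [neighborWords, List.flatMap_cons, List.length_append, endCount, Sym2.lift_mk]
    congr 2 <;> split_ifs <;> rfl

variable [Fintype K] [NeZero q]

/-- Every node receives two words in the first round, its degree. -/
theorem sum_length_neighborWords_edges {M : Type} [Fintype M] {S : ℕ} (θ : RegularInput n M S)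
    (v : Fin n) : ∑ i, (neighborWords (θ.edges i) v).length = 2 := by
  classical
  have h₁ : ∑ i, (neighborWords (θ.edges i) v).length =
      (((θ.graph.edgeSet.toFinite.toFinset).val).map (endCount v)).sum := by
    rw [← θ.sum_map_edges]
    simp only [length_neighborWords]
    rw [← Multiset.coe_mapAddMonoidHom, map_sum, ← Multiset.coe_sumAddMonoidHom, map_sum]
  have h₂ : ∀ e ∈ θ.graph.edgeSet.toFinite.toFinset, endCount v e = if v ∈ e then 1 else 0 := by
    intro e he
    rw [Set.Finite.mem_toFinset] at he
    induction e using Sym2.ind with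
    | _ a b =>
    have hab : a ≠ b := (SimpleGraph.mem_edgeSet _).1 he |>.ne
    simp only [endCount, Sym2.lift_mk, Sym2.mem_iff]
    by_cases ha : a = v
    · simp [ha, show b ≠ v from fun h => hab (ha.trans h.symm)]
    · by_cases hb : b = v
      · simp [ha, hb]
      · simp [ha, hb, Ne.symm ha, Ne.symm hb]
  rw [h₁]
  change ∑ e ∈ θ.graph.edgeSet.toFinite.toFinset, endCount v e = 2
  rw [Finset.sum_congr rfl h₂, ← Finset.card_filter, ← θ.ncard_neighborSet v,
    Set.ncard_eq_toFinset_card',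
    ← SimpleGraph.neighborFinset_def, SimpleGraph.card_neighborFinset_eq_degree,
    ← SimpleGraph.card_incidenceFinset_eq_degree]
  congr 1
  ext e
  simp [SimpleGraph.mem_incidenceFinset, SimpleGraph.incidenceSet]

/-- The neighbors of a node, in the order of its ports. -/
noncomputable def portData [NeZero n] (G : SimpleGraph (Fin n)) (v : Fin n) : List ℕ :=
  [(port (G.neighborSet v) false : ℕ), (port (G.neighborSet v) true : ℕ)]

theorem portData_eq_iff [NeZero n] {G G' : SimpleGraph (Fin n)} {v : Fin n} :
    portData G v = portData G' v ↔ port (G.neighborSet v) = port (G'.neighborSet v) := by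
  simp only [portData, List.cons.injEq, and_true, funext_iff, Bool.forall_bool, Fin.ext_iff]

variable {S W : ℕ}

/-- The words received in the first round determine the neighbors of a node. -/
theorem RegularInput.adj_iff {M : Type} [Fintype M] (θ : RegularInput n M S) (v u : Fin n) :
    θ.graph.Adj v u ↔ ∃ i, (u : ℕ) ∈ neighborWords (θ.edges i) v := by
  have h : s(v, u) ∈ (θ.graph.edgeSet.toFinite.toFinset).val ↔ θ.graph.Adj v u := by simp
  rw [← h, ← θ.sum_map_edges, Multiset.mem_sum]
  simp only [mem_neighborWords, Finset.mem_univ, true_and, Multiset.map_coe, Multiset.mem_coe,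
    List.mem_map]

/-- In the first round the ends of every edge get to know each other. -/
theorem oneRound_start [NeZero n] (hS : 4 ≤ S) (hW : n ≤ W) :
    OneRound S W (fun θ : RegularInput n (SimMachine n q K) S => θ.start)
      (spread 0 fun θ => portData θ.graph) := by
  classical
  refine ⟨fun θ i i' => match i' with
    | Sum.inl (v, a) => if a = 0 then neighborWords (θ.edges i) v else []
    | Sum.inr _ => [], ?_, ?_, ?_⟩
  · intro θ θ' i h
    funext i'
    rcases i' with ⟨v, a⟩ | _
    · simp only [RegularInput.edges_eq_of_start_eq h]
    · rfl
  · rintro θ θ' (⟨v, a⟩ | _) - h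
    · by_cases ha : a = 0
      · subst ha
        simp only [if_true] at h
        simp only [spread_zero_inl_zero]
        refine portData_eq_iff.2 (congrArg port ?_)
        ext u
        simp only [SimpleGraph.mem_neighborSet, RegularInput.adj_iff, h]
      · have ha' : ¬ ∀ m : Fin 4, 0 ≤ (m : ℕ) → a m = 0 := fun h =>
          ha (funext fun m => h m (Nat.zero_le _))
        simp only [spread, if_neg ha']
    · rfl
  · rintro θ i
    refine ⟨?_, ?_, ?_⟩
    · rw [Fintype.sum_sum_type]
      simp only [List.length_nil, Finset.sum_const_zero, add_zero]
      rw [Fintype.sum_prod_type]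
      have h : ∀ v, ∑ a : Fin 4 → Fin q,
          (if a = 0 then neighborWords (θ.edges i) v else []).length =
            (neighborWords (θ.edges i) v).length := fun v => by
        rw [Finset.sum_eq_single (a := 0)]
        · simp
        · intro a _ ha
          simp [ha]
        · simp
      simp only [h, sum_length_neighborWords]
      refine le_trans (le_of_eq ?_) (θ.length_start_le i)
      rw [θ.start_eq, length_flatMap_pair]
    · rcases i with ⟨v, a⟩ | _
      · by_cases ha : a = 0
        · simp only [ha, if_true]
          rw [sum_length_neighborWords_edges]
          omega
        · simp [ha]
      · simp
    · rintro (⟨v, a⟩ | _) w hw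
      · simp only at hw
        split_ifs at hw
        · exact (neighborWords_lt w hw).trans_le hW
        · simp at hw
      · simp at hw

/-- In the second round every node tells its neighbors whether they are behind its first port. -/
theorem oneRound_portData [NeZero n] (hS : 4 ≤ S) (hW : 2 ≤ W) {Θ : Type}
    (G : Θ → SimpleGraph (Fin n)) (hG : ∀ θ v, ((G θ).neighborSet v).ncard = 2) :
    OneRound S W (spread (q := q) (K := K) 0 fun θ => portData (G θ))
      (spread 0 fun θ => nodeData (dartPerm (G θ) (hG θ)) 1) := by
  classical
  have hmsg : ∀ θ (v u : Fin n), (∃ b, port ((G θ).neighborSet v) b = u) →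
      u ∈ Finset.univ.image (port ((G θ).neighborSet v)) := fun θ v u ⟨b, hb⟩ =>
    Finset.mem_image.2 ⟨b, Finset.mem_univ _, hb⟩
  have hcard : ∀ θ v, (Finset.univ.image (port ((G θ).neighborSet v))).card ≤ 2 := fun θ v =>
    Finset.card_image_le.trans (by simp)
  refine ⟨fun θ i i' => match i, i' with
    | Sum.inl (v, a), Sum.inl (u, a') =>
      if a = 0 ∧ a' = 0 ∧ ∃ b, port ((G θ).neighborSet v) b = u then
        [(decide (port ((G θ).neighborSet v) false = u)).toNat] else []
    | _, _ => [], ?_, ?_, ?_⟩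
  · rintro θ θ' (⟨v, a⟩ | _) h <;> funext i'
    · rcases i' with ⟨u, a'⟩ | _
      · by_cases ha : a = 0
        · subst ha
          simp only [spread_zero_inl_zero] at h
          simp only [portData_eq_iff.1 h]
        · simp [ha]
      · rfl
    · rfl
  · rintro θ θ' (⟨u, a⟩ | _) h₁ h₂
    · by_cases ha : a = 0
      · subst ha
        simp only [spread_zero_inl_zero] at h₁ ⊢
        rw [portData_eq_iff] at h₁
        refine nodeData_eq_iff.2 ⟨fun b => ?_, fun _ => rfl⟩
        have h := h₂ (Sum.inl (port ((G θ).neighborSet u) b, 0))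
        have hb : ∃ b', port ((G θ).neighborSet (port ((G θ).neighborSet u) b)) b' = u :=
          (exists_port_eq (hG θ)).2 ((exists_port_eq (hG θ)).1 ⟨b, rfl⟩).symm
        have hb' : ∃ b', port ((G θ').neighborSet (port ((G θ).neighborSet u) b)) b' = u := by
          rw [h₁]
          exact (exists_port_eq (hG θ')).2 ((exists_port_eq (hG θ')).1 ⟨b, rfl⟩).symm
        simp only [hb, hb', and_self, if_true, List.cons.injEq, and_true] at h
        change dartStep (G θ) (u, b) = dartStep (G θ') (u, b)
        simp only [dartStep, ← h₁, Prod.mk.injEq, true_and]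
        have hinj : ∀ x y : Bool, x.toNat = y.toNat → x = y := by decide
        exact hinj _ _ h
      · have ha' : ¬ ∀ m : Fin 4, 0 ≤ (m : ℕ) → a m = 0 := fun h =>
          ha (funext fun m => h m (Nat.zero_le _))
        simp only [spread, if_neg ha']
    · rfl
  · have hlen : ∀ (p : Prop) [Decidable p] (x : ℕ), (if p then [x] else []).length ≤ 1 := by
      intro p _ x
      split_ifs <;> simp
    rintro θ (⟨v, a⟩ | _)
    · refine ⟨?_, ?_, ?_⟩
      · refine sum_le_card_mul_of_support _
          ((Finset.univ.image (port ((G θ).neighborSet v))).image fun u => Sum.inl (u, 0)) 1 S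
          ?_ ?_ ((Nat.mul_le_mul_right 1 (Finset.card_image_le.trans (hcard θ v))).trans (by omega))
        · rintro (⟨u, a'⟩ | _) h
          · obtain ⟨-, rfl, h'⟩ := of_length_ite_ne_zero h
            exact Finset.mem_image_of_mem _ (hmsg θ v u h')
          · simp at h
        · rintro (⟨u, a'⟩ | _)
          · exact hlen _ _
          · simp
      · refine sum_le_card_mul_of_support _
          ((Finset.univ.image (port ((G θ).neighborSet v))).image fun u => Sum.inl (u, 0)) 1 S
          ?_ ?_ ((Nat.mul_le_mul_right 1 (Finset.card_image_le.trans (hcard θ v))).trans (by omega))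
        · rintro (⟨u, a'⟩ | _) h
          · obtain ⟨rfl, -, h'⟩ := of_length_ite_ne_zero h
            exact Finset.mem_image_of_mem _ (hmsg θ v u
              ((exists_port_eq (hG θ)).2 ((exists_port_eq (hG θ)).1 h').symm))
          · simp at h
        · rintro (⟨u, a'⟩ | _)
          · exact hlen _ _
          · simp
      · rintro (⟨u, a'⟩ | _) w hw
        · simp only at hw
          split_ifs at hw
          · rw [List.mem_singleton] at hw
            have := (decide (port ((G θ).neighborSet v) false = u)).toNat_lt
            omega
          · simp at hw
        · simp at hw
    · refine ⟨by simp, ?_, by simp⟩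
      rw [Fintype.sum_sum_type]
      simp

theorem computes_dartPerm [NeZero n] (hS : 4 ≤ S) (hW : 2 * n ≤ W) :
    Computes S W 2 (fun θ : RegularInput n (SimMachine n q K) S => θ.start)
      (spread 0 fun θ => nodeData (dartPerm θ.graph θ.ncard_neighborSet) 1) := by
  have hn : 1 ≤ n := NeZero.one_le
  have h₀ : Fits S W fun θ : RegularInput n (SimMachine n q K) S => θ.start := by
    refine fun θ i => ⟨θ.length_start_le i, fun w hw => ?_⟩
    beta_reduce at hw
    rw [θ.start_eq, List.mem_flatMap] at hw
    obtain ⟨e, -, he⟩ := hw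
    simp only [List.mem_cons, List.not_mem_nil, or_false] at he
    omega
  have h₁ : Fits S W (spread (q := q) (K := K) 0
      fun θ : RegularInput n (SimMachine n q K) S => portData θ.graph) := by
    refine fits_spread 0 hS (fun θ v => by simp [portData]) fun θ v w hw => ?_
    simp only [portData, List.mem_cons, List.not_mem_nil, or_false] at hw
    omega
  exact ((Computes.refl h₀).step (oneRound_start hS (by omega)) h₁).step
    (oneRound_portData hS (by omega) _ _)
    (fits_spread 0 hS (fun θ v => le_rfl) fun θ v => nodeData_lt hW _ _ v)

end Preprocessing

/-! ### The algorithm for the 1 vs. 2 cycles problem -/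

section Assembly

/-- The algorithm that runs `B n` on inputs with `n` nodes. -/
def MPCAlgorithm.diagonal (B : ℕ → MPCAlgorithm) : MPCAlgorithm where
  Machine n := (B n).Machine n
  Seed n := (B n).Seed n
  rounds n := (B n).rounds n
  send n := (B n).send n
  update n := (B n).update n
  outMachine n := (B n).outMachine n
  answer n := (B n).answer n

theorem MPCAlgorithm.mem_diagonal (B : ℕ → MPCAlgorithm) (n : ℕ) (ω : (B n).Seed n)
    (start : (B n).Machine n → List ℕ) (r : ℕ) :
    (MPCAlgorithm.diagonal B).mem n ω start r = (B n).mem n ω start r := by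
  induction r with
  | zero => rfl
  | succ r ih =>
    simp only [MPCAlgorithm.mem, ih]
    rfl

theorem MPCAlgorithm.succeeds_diagonal (B : ℕ → MPCAlgorithm) {δ : ℝ} {b n : ℕ}
    {ω : (B n).Seed n} {start : (B n).Machine n → List ℕ} {ans : Bool}
    (h : (B n).Succeeds δ b n start ans ω) :
    (MPCAlgorithm.diagonal B).Succeeds δ b n start ans ω := by
  unfold MPCAlgorithm.Succeeds MPCAlgorithm.Respects MPCAlgorithm.output MPCAlgorithm.msg at h ⊢
  simp only [MPCAlgorithm.mem_diagonal]
  exact h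

/-- A graph with at most as many edges as there are machines can be distributed among them. -/
theorem exists_isInputDistribution {M : Type} [Fintype M] {n S : ℕ} (G : SimpleGraph (Fin n))
    (hM : n * n ≤ Fintype.card M) (hS : 2 ≤ S) :
    ∃ start : M → List ℕ, IsInputDistribution G [] start ∧ ∀ i, (start i).length ≤ S := by
  classical
  obtain ⟨f⟩ : Nonempty (Fin n × Fin n ↪ M) :=
    Function.Embedding.nonempty_of_card_le (by simpa using hM)
  let g : Sym2 (Fin n) → M := fun e => f (Quot.out e)
  have hout : ∀ e : Sym2 (Fin n), s((Quot.out e).1, (Quot.out e).2) = e := fun e => Quot.out_eq e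
  have hg : Function.Injective g := fun e e' h => by
    rw [← hout e, ← hout e', f.injective h]
  let L : M → List (Fin n × Fin n) := fun i => ((G.edgeFinset.filter (g · = i)).toList).map Quot.out
  refine ⟨fun i => (L i).flatMap (fun e => [(e.1 : ℕ), (e.2 : ℕ)]),
    isInputDistribution_iff.2 ⟨L, ?_, fun i => rfl⟩, fun i => ?_⟩
  · have h : ∀ i, ((L i : Multiset (Fin n × Fin n)).map fun e => s(e.1, e.2)) =
        ∑ e ∈ G.edgeFinset with g e = i, {e} := by
      intro i
      rw [← Multiset.map_coe, Finset.coe_toList, Multiset.map_map, Finset.sum,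
        Multiset.sum_map_singleton]
      exact (Multiset.map_congr rfl fun e _ => hout e).trans (Multiset.map_id _)
    rw [Finset.sum_congr rfl fun i _ => h i]
    refine (Finset.sum_fiberwise _ _ _).trans ?_
    rw [Finset.sum, Multiset.sum_map_singleton]
  · rw [length_flatMap_pair, List.length_map, Finset.length_toList]
    have : (G.edgeFinset.filter (g · = i)).card ≤ 1 := Finset.card_le_one.2 fun a ha b hb =>
      hg ((Finset.mem_filter.1 ha).2.trans (Finset.mem_filter.1 hb).2.symm)
    omega

/-- The reduction for graphs on `n` nodes, with the numerical conditions as hypotheses: `2 * r` is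
the length of the paths in the layered graphs, which have `N` nodes, and `J` is the number of
applications of the path-connectivity algorithm. -/
theorem exists_algorithm_at (A : MPCAlgorithm) {C δ δ' : ℝ} {D : ℕ → ℕ} {b b' r q n N J : ℕ}
    (hn : 1 ≤ n) (hr : 1 ≤ r) (hrD : ((2 * r : ℕ) : ℝ) ≤ C * D N)
    (hA : ∀ (G : SimpleGraph (Fin N)) (special : List (Fin N)) (ans : Bool),
      (pathConnectivity C D).inst N G special ans →
      (∃ start : A.Machine N → List ℕ, IsInputDistribution G special start ∧
        ∀ i, (start i).length ≤ localMemory δ N) ∧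
      ∀ start : A.Machine N → List ℕ, IsInputDistribution G special start →
        (∀ i, (start i).length ≤ localMemory δ N) →
        ∀ ω, ω ∈ {ω | A.Succeeds δ b N start ans ω})
    (hN : 2 * n * (2 * r + 1) ≤ N) (hqn : 2 * n ≤ q ^ 2) (hq : 4 * q ≤ localMemory δ' n)
    (hrS : 16 * r ≤ localMemory δ' n) (hAS : 2 * localMemory δ N ≤ localMemory δ' n)
    (hnW : 2 * n ≤ n ^ b') (hAW : N ^ b ≤ n ^ b') (hJ : n < r ^ J) :
    ∃ B : MPCAlgorithm,
      Fintype.card (B.Machine n) = n * q ^ 4 + 4 * n ^ 2 * Fintype.card (A.Machine N) ∧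
      B.rounds n = 2 + J * (A.rounds N + 6) ∧
      ∀ (G : SimpleGraph (Fin n)) (special : List (Fin n)) (ans : Bool),
        oneVsTwoCycles.inst n G special ans →
        (∃ start : B.Machine n → List ℕ, IsInputDistribution G special start ∧
          ∀ i, (start i).length ≤ localMemory δ' n) ∧
        ∀ start : B.Machine n → List ℕ, IsInputDistribution G special start →
          (∀ i, (start i).length ≤ localMemory δ' n) →
          ∀ ω, B.Succeeds δ' b' n start ans ω := by
  classical
  have hq0 : q ≠ 0 := by
    rintro rfl
    omega
  have : NeZero q := ⟨hq0⟩
  have : NeZero n := ⟨by omega⟩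
  have hS4 : 4 ≤ localMemory δ' n := by omega
  have hcomp := (computes_dartPerm (n := n) (q := q) (K := A.Machine N) hS4 hnW).trans
    (computes_pow A hr hrD hA hN hqn hq hrS hAS hnW hAW
      (fun θ : RegularInput n (SimMachine n q (A.Machine N)) (localMemory δ' n) =>
        dartPerm θ.graph θ.ncard_neighborSet) J (n / 2) ((Nat.div_le_self n 2).trans_lt hJ))
  obtain ⟨send, update, hrun⟩ := hcomp.exists_protocol
  let out : SimMachine n q (A.Machine N) := Sum.inl (0, 0)
  let B : MPCAlgorithm :=
    { Machine := fun _ => SimMachine n q (A.Machine N)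
      Seed := fun _ => Unit
      rounds := fun _ => 2 + J * (A.rounds N + 6)
      send := fun _ _ => send
      update := fun _ _ => update
      outMachine := fun _ => out
      -- the data of the node `0` determine whether the traversal from its first dart returned to it
      answer := fun _ _ m => decide (∃ θ : RegularInput n (SimMachine n q (A.Machine N))
        (localMemory δ' n), nodeData (dartPerm θ.graph θ.ncard_neighborSet)
          (dartPerm θ.graph θ.ncard_neighborSet ^ (n / 2)) 0 = m ∧
        ((dartPerm θ.graph θ.ncard_neighborSet ^ (n / 2)) (0, false)).1 ≠ 0) }
  have hmem : ∀ ω start r, B.mem n ω start r = runMem send update start r := by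
    intro ω start r
    induction r with
    | zero => rfl
    | succ r ih =>
      simp only [MPCAlgorithm.mem, runMem, ih]
      rfl
  refine ⟨B, ?_, rfl, fun G special ans hinst => ⟨?_, fun start hstart hfit ω => ?_⟩⟩
  · change Fintype.card (SimMachine n q (A.Machine N)) = _
    simp only [Fintype.card_sum, Fintype.card_prod, Fintype.card_fin, Fintype.card_bool,
      Fintype.card_pi, Finset.prod_const, Finset.card_univ]
    ring
  · obtain rfl := hinst.1
    refine exists_isInputDistribution G ?_ (by omega)
    change n * n ≤ Fintype.card (SimMachine n q (A.Machine N))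
    have : 0 < Fintype.card (A.Machine N) := Fintype.card_pos_iff.2 ⟨A.outMachine N⟩
    simp only [Fintype.card_sum, Fintype.card_prod, Fintype.card_fin, Fintype.card_bool,
      Fintype.card_pi, Finset.prod_const, Finset.card_univ]
    nlinarith [Nat.zero_le (n * q ^ 4), Nat.mul_le_mul_left (n * n) this]
  · have hG := ncard_neighborSet_of_oneVsTwoCycles hinst
    obtain ⟨rfl, k, hk, hnk, hans⟩ := hinst
    let θ : RegularInput n (SimMachine n q (A.Machine N)) (localMemory δ' n) :=
      ⟨G, start, hG, hstart, hfit⟩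
    obtain ⟨h₁, h₂, h₃⟩ := hrun θ
    refine ⟨⟨fun r hr i => ?_, fun r hr i => ?_⟩, ?_⟩
    · rw [hmem]
      exact h₂ r hr i
    · simp only [MPCAlgorithm.msg, hmem]
      exact h₃ r hr i
    · have hk2 : n / 2 = k := by omega
      have hout : B.mem n ω start (B.rounds n) (B.outMachine n) =
          nodeData (dartPerm G hG) (dartPerm G hG ^ (n / 2)) 0 := by
        rw [hmem]
        exact (congrFun h₁ out).trans (spread_zero_inl_zero _ θ 0)
      have hiff := dartPerm_pow_eq_iff hk hnk hans hG (0, false)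
      rw [← hk2] at hiff
      rw [MPCAlgorithm.output, hout]
      change decide _ = ans
      cases ans
      · refine decide_eq_false ?_
        rintro ⟨θ', hθ', hne⟩
        refine hne ?_
        rw [(nodeData_eq_iff.1 hθ').2 false]
        exact hiff.2 rfl
      · exact decide_eq_true ⟨θ, rfl, fun h => by simpa using hiff.1 h⟩

end Assembly

/-! ### Growth estimates -/

section Growth

theorem eventually_mul_rpow_le (K : ℝ) {a b : ℝ} (hab : a < b) :
    ∀ᶠ n : ℕ in atTop, K * (n : ℝ) ^ a ≤ (n : ℝ) ^ b := by
  have h := ((tendsto_rpow_atTop (sub_pos.2 hab)).comp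
    tendsto_natCast_atTop_atTop).eventually_ge_atTop K
  filter_upwards [h, eventually_gt_atTop 0] with n hn hpos
  have hn0 : (0 : ℝ) < n := by exact_mod_cast hpos
  calc K * (n : ℝ) ^ a ≤ (n : ℝ) ^ (b - a) * (n : ℝ) ^ a := by
        gcongr
        exact hn
    _ = (n : ℝ) ^ b := by rw [← Real.rpow_add hn0, sub_add_cancel]

/-- Local memory `n ^ ((2 + δ) / 3)` is enough to simulate machines with local memory `N ^ δ` for a
slightly superlinear number `N` of nodes, and to broadcast with a fan-out of order `√n`. -/
theorem eventually_localMemory_le {δ : ℝ} (h0 : 0 < δ) (h1 : δ < 1) :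
    ∀ᶠ n : ℕ in atTop,
      1 ≤ ⌊(n : ℝ) ^ ((1 - δ) / 3)⌋₊ ∧
      2 * n * ⌊(n : ℝ) ^ ((1 - δ) / 3)⌋₊ ≤ n ^ 2 ∧
      4 * (Nat.sqrt (2 * n) + 1) ≤ localMemory ((2 + δ) / 3) n ∧
      16 * ⌊(n : ℝ) ^ ((1 - δ) / 3)⌋₊ ≤ localMemory ((2 + δ) / 3) n ∧
      2 * localMemory δ (2 * n * ⌊(n : ℝ) ^ ((1 - δ) / 3)⌋₊) ≤ localMemory ((2 + δ) / 3) n := by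
  filter_upwards [eventually_mul_rpow_le 2 (show (1 - δ) / 3 < 1 by linarith),
    eventually_mul_rpow_le 12 (show (1 / 2 : ℝ) < (2 + δ) / 3 by linarith),
    eventually_mul_rpow_le 16 (show (1 - δ) / 3 < (2 + δ) / 3 by linarith),
    eventually_mul_rpow_le 4 (show (1 + (1 - δ) / 3) * δ < (2 + δ) / 3 by nlinarith),
    eventually_ge_atTop 1] with n h₁ h₂ h₃ h₄ hn
  have hn1 : (1 : ℝ) ≤ n := by exact_mod_cast hn
  have hn0 : (0 : ℝ) < n := by linarith
  set m := ⌊(n : ℝ) ^ ((1 - δ) / 3)⌋₊ with hm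
  have hm_le : (m : ℝ) ≤ (n : ℝ) ^ ((1 - δ) / 3) := Nat.floor_le (by positivity)
  refine ⟨?_, ?_, ?_, ?_, ?_⟩
  · rw [Nat.one_le_floor_iff]
    exact Real.one_le_rpow hn1 (by linarith)
  · rw [Real.rpow_one] at h₁
    have : (2 * m : ℝ) ≤ n := by linarith
    have : 2 * m ≤ n := by exact_mod_cast this
    calc 2 * n * m = n * (2 * m) := by ring
      _ ≤ n * n := Nat.mul_le_mul_left n this
      _ = n ^ 2 := (sq n).symm
  · refine Nat.le_floor ?_
    refine le_trans ?_ h₂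
    have hs : (Nat.sqrt (2 * n) : ℝ) ≤ 2 * (n : ℝ) ^ (1 / 2 : ℝ) := by
      rw [← Real.sqrt_eq_rpow]
      refine (Real.nat_sqrt_le_real_sqrt).trans ?_
      rw [Real.sqrt_le_left (by positivity), mul_pow, Real.sq_sqrt hn0.le]
      push_cast
      linarith
    have h1' : (1 : ℝ) ≤ (n : ℝ) ^ (1 / 2 : ℝ) := Real.one_le_rpow hn1 (by norm_num)
    push_cast
    linarith
  · refine Nat.le_floor ?_
    push_cast
    linarith
  · refine Nat.le_floor ?_
    rw [Nat.cast_mul, Nat.cast_ofNat]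
    refine le_trans ?_ h₄
    have h : (localMemory δ (2 * n * m) : ℝ) ≤ 2 * (n : ℝ) ^ ((1 + (1 - δ) / 3) * δ) := by
      refine (Nat.floor_le (by positivity)).trans ?_
      calc ((2 * n * m : ℕ) : ℝ) ^ δ ≤ (2 * (n : ℝ) ^ (1 + (1 - δ) / 3)) ^ δ := by
            refine Real.rpow_le_rpow (by positivity) ?_ h0.le
            rw [Real.rpow_add hn0, Real.rpow_one]
            push_cast
            rw [mul_assoc]
            gcongr
        _ = 2 ^ δ * (n : ℝ) ^ ((1 + (1 - δ) / 3) * δ) := by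
            rw [Real.mul_rpow (by norm_num) (by positivity), ← Real.rpow_mul hn0.le]
        _ ≤ 2 * (n : ℝ) ^ ((1 + (1 - δ) / 3) * δ) := by
            gcongr
            calc (2 : ℝ) ^ δ ≤ 2 ^ (1 : ℝ) := Real.rpow_le_rpow_of_exponent_le (by norm_num) h1.le
              _ = 2 := Real.rpow_one 2
    linarith

theorem tendsto_atTop_of_log_isBigO {D : ℕ → ℕ}
    (hD : (fun n : ℕ => Real.log (n : ℝ)) =O[atTop] (fun n : ℕ => (D n : ℝ))) :
    Tendsto (fun n => (D n : ℝ)) atTop atTop := by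
  have h := (isBigO_iff'.1 hD)
  obtain ⟨c, hc, h⟩ := h
  have hlog : Tendsto (fun n : ℕ => Real.log (n : ℝ) / c) atTop atTop :=
    (Real.tendsto_log_atTop.comp tendsto_natCast_atTop_atTop).atTop_div_const hc
  refine tendsto_atTop_mono' _ ?_ hlog
  filter_upwards [h] with n hn
  rw [div_le_iff₀' hc]
  exact (le_abs_self _).trans (by simpa using hn)

/-- As the diameter is `N ^ o(1)`, layered graphs with `2 * r` layers of edges, for the largest `r`
allowed by the diameter, have at most `n ^ γ` layers. -/
theorem eventually_diameter_le {D N : ℕ → ℕ} {ε : ℕ → ℝ} (hε : Tendsto ε atTop (𝓝 0))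
    (hD : ∀ᶠ n : ℕ in atTop, (D n : ℝ) = (n : ℝ) ^ ε n) (C : ℝ) (hC : 0 < C) {γ : ℝ} (hγ : 0 < γ)
    (hN : Tendsto N atTop atTop) (hN2 : ∀ᶠ n in atTop, N n ≤ n ^ 2) :
    ∀ᶠ n : ℕ in atTop, 2 * ⌊C * D (N n) / 2⌋₊ + 1 ≤ ⌊(n : ℝ) ^ γ⌋₊ := by
  have hε' := hN.eventually ((hε.eventually_lt_const (show 0 < γ / 4 by linarith)).and hD)
  filter_upwards [hε', hN2, eventually_mul_rpow_le (C + 1) (show γ / 2 < γ by linarith),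
    eventually_ge_atTop 1, hN.eventually_ge_atTop 1] with n hn hNn h hn1 hN1
  refine Nat.le_floor ?_
  refine le_trans ?_ h
  have hn1' : (1 : ℝ) ≤ n := by exact_mod_cast hn1
  have hN1' : (1 : ℝ) ≤ N n := by exact_mod_cast hN1
  have hDle : (D (N n) : ℝ) ≤ (n : ℝ) ^ (γ / 2) := by
    rw [hn.2]
    calc (N n : ℝ) ^ ε (N n) ≤ (N n : ℝ) ^ (γ / 4) :=
          Real.rpow_le_rpow_of_exponent_le hN1' hn.1.le
      _ ≤ ((n : ℝ) ^ (2 : ℝ)) ^ (γ / 4) := by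
          refine Real.rpow_le_rpow (by positivity) ?_ (by positivity)
          rw [Real.rpow_two]
          exact_mod_cast hNn
      _ = (n : ℝ) ^ (γ / 2) := by
          rw [← Real.rpow_mul (by positivity)]
          congr 1
          ring
  have hone : (1 : ℝ) ≤ (n : ℝ) ^ (γ / 2) := Real.one_le_rpow hn1' (by positivity)
  have hfloor : (⌊C * D (N n) / 2⌋₊ : ℝ) ≤ C * D (N n) / 2 := Nat.floor_le (by positivity)
  have := mul_le_mul_of_nonneg_left hDle hC.le
  push_cast
  linarith

/-- Multiplying by a positive constant and rounding down changes the logarithm by a bounded factor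
only. -/
theorem log_isBigO_log_floor {d : ℕ → ℝ} (hd : Tendsto d atTop atTop) {C : ℝ} (hC : 0 < C) :
    (fun n => Real.log (d n)) =O[atTop] (fun n => Real.log (⌊C * d n / 2⌋₊ : ℝ)) := by
  refine IsBigO.of_bound 2 ?_
  -- it suffices that the rounded value exceeds the square root
  have hsqrt : ∀ᶠ x : ℝ in atTop, √x ≤ C * x / 2 - 1 := by
    filter_upwards [eventually_ge_atTop (max 1 ((4 / C) ^ 2)),
      eventually_ge_atTop (4 / C)] with x hx hx'
    have hx1 : 1 ≤ x := (le_max_left _ _).trans hx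
    have h1 : 4 / C ≤ √x := Real.le_sqrt_of_sq_le ((le_max_right _ _).trans hx)
    have h2 : √x * √x = x := Real.mul_self_sqrt (by linarith)
    rw [div_le_iff₀ hC] at h1 hx'
    nlinarith [Real.sqrt_nonneg x, mul_le_mul_of_nonneg_left h1 (Real.sqrt_nonneg x)]
  filter_upwards [hd.eventually hsqrt, hd.eventually_ge_atTop 1] with n hn h1
  have hf : √(d n) ≤ (⌊C * d n / 2⌋₊ : ℝ) := by
    have := Nat.lt_floor_add_one (C * d n / 2)
    linarith
  have hs : 1 ≤ √(d n) := Real.one_le_sqrt.2 h1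
  rw [Real.norm_of_nonneg (Real.log_nonneg h1),
    Real.norm_of_nonneg (Real.log_nonneg (hs.trans hf))]
  have := Real.log_le_log (by linarith) hf
  rw [Real.log_sqrt (by linarith)] at this
  linarith

/-- The number of rounds: `log n / log r` stages of `o(log r)` rounds take `o(log n)` rounds. -/
theorem rounds_isLittleO {r T : ℕ → ℕ} (hr : Tendsto r atTop atTop) (hrn : ∀ᶠ n in atTop, r n ≤ n)
    (hT : (fun n => (T n : ℝ)) =o[atTop] fun n => Real.log (r n : ℝ)) :
    (fun n => ((2 + (Nat.log (r n) n + 1) * (T n + 6) : ℕ) : ℝ)) =o[atTop]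
      fun n : ℕ => Real.log (n : ℝ) := by
  refine IsLittleO.of_bound fun η hη => ?_
  have hlogr : Tendsto (fun n => Real.log (r n : ℝ)) atTop atTop :=
    Real.tendsto_log_atTop.comp (tendsto_natCast_atTop_atTop.comp hr)
  have hlogn : Tendsto (fun n : ℕ => Real.log (n : ℝ)) atTop atTop :=
    Real.tendsto_log_atTop.comp tendsto_natCast_atTop_atTop
  filter_upwards [hT.bound (show 0 < η / 8 by linarith), hlogr.eventually_ge_atTop (48 / η),
    hlogn.eventually_ge_atTop (4 / η), hrn, hr.eventually_ge_atTop 2] with n h₁ h₂ h₃ h₄ h₅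
  have hr1 : (1 : ℝ) < r n := by exact_mod_cast h₅
  have hlr : 0 < Real.log (r n) := Real.log_pos hr1
  have hle : Real.log (r n) ≤ Real.log n :=
    Real.log_le_log (by linarith) (by exact_mod_cast h₄)
  rw [Real.norm_of_nonneg hlr.le, Real.norm_of_nonneg (Nat.cast_nonneg _)] at h₁
  rw [Real.norm_of_nonneg (Nat.cast_nonneg _), Real.norm_of_nonneg (hlr.le.trans hle)]
  have hlog : (Nat.log (r n) n : ℝ) * Real.log (r n) ≤ Real.log n := by
    rw [← Real.log_pow]
    refine Real.log_le_log (by positivity) ?_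
    exact_mod_cast Nat.pow_log_le_self _ (by omega)
  rw [div_le_iff₀ hη] at h₂ h₃
  have hT6 : (T n : ℝ) + 6 ≤ η / 4 * Real.log (r n) := by linarith
  push_cast
  calc (2 : ℝ) + (Nat.log (r n) n + 1) * (T n + 6)
      ≤ 2 + (Nat.log (r n) n + 1) * (η / 4 * Real.log (r n)) := by gcongr
    _ = 2 + η / 4 * (Nat.log (r n) n * Real.log (r n) + Real.log (r n)) := by ring
    _ ≤ 2 + η / 4 * (Real.log n + Real.log n) := by gcongr
    _ ≤ η * Real.log n := by linarith

end Growth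

/-! ### The reduction -/

section Reduction

theorem globalMemory_le {n q K S c : ℕ} (hn : 4 ≤ n) (hq : q ≤ n) (hS : S ≤ n)
    (hK : K ≤ n ^ (2 * c)) : (n * q ^ 4 + 4 * n ^ 2 * K) * S ≤ n ^ (2 * c + 7) := by
  have h₁ : n * q ^ 4 ≤ n ^ (2 * c + 5) := by
    calc n * q ^ 4 ≤ n * n ^ 4 := by gcongr
      _ = n ^ 5 := by ring
      _ ≤ n ^ (2 * c + 5) := Nat.pow_le_pow_right (by omega) (by omega)
  have h₂ : 4 * n ^ 2 * K ≤ n ^ (2 * c + 5) := by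
    calc 4 * n ^ 2 * K ≤ n * n ^ 2 * n ^ (2 * c) := by gcongr
      _ = n ^ (2 * c + 3) := by ring
      _ ≤ n ^ (2 * c + 5) := Nat.pow_le_pow_right (by omega) (by omega)
  calc (n * q ^ 4 + 4 * n ^ 2 * K) * S ≤ (n ^ (2 * c + 5) + n ^ (2 * c + 5)) * n := by gcongr
    _ = 2 * n ^ (2 * c + 6) := by ring
    _ ≤ n * n ^ (2 * c + 6) := by gcongr; omega
    _ = n ^ (2 * c + 7) := by ring

/-- A path-connectivity algorithm with `o(log D)` rounds yields an algorithm for the 1 vs. 2 cycles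
problem with `o(log n)` rounds. -/
theorem exists_fast_algorithm (D : ℕ → ℕ)
    (hD_lower : (fun n : ℕ => Real.log (n : ℝ)) =O[atTop] (fun n : ℕ => (D n : ℝ)))
    (hD_upper : ∃ ε : ℕ → ℝ, Tendsto ε atTop (𝓝 0) ∧
      ∀ᶠ n : ℕ in atTop, (D n : ℝ) = (n : ℝ) ^ ε n)
    (C : ℝ) (hC : 0 < C) (A : MPCAlgorithm) (δ : ℝ) (b c : ℕ) (h0 : 0 < δ) (h1 : δ < 1)
    (hmem : A.GlobalMemoryLE δ c) (hA : A.Solves δ b (pathConnectivity C D))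
    (hrounds : (fun n : ℕ => (A.rounds n : ℝ)) =o[atTop] (fun n : ℕ => Real.log (D n : ℝ))) :
    ∃ B : MPCAlgorithm, B.GlobalMemoryLE ((2 + δ) / 3) (2 * c + 7) ∧
      B.SolvesWHP ((2 + δ) / 3) (2 * b + 2) oneVsTwoCycles ∧
      (fun n : ℕ => (B.rounds n : ℝ)) =o[atTop] fun n : ℕ => Real.log (n : ℝ) := by
  classical
  obtain ⟨ε, hε, hDε⟩ := hD_upper
  set γ : ℝ := (1 - δ) / 3 with hγ
  set m : ℕ → ℕ := fun n => ⌊(n : ℝ) ^ γ⌋₊ with hm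
  set N : ℕ → ℕ := fun n => 2 * n * m n with hNdef
  set r : ℕ → ℕ := fun n => ⌊C * D (N n) / 2⌋₊ with hrdef
  have hnum := eventually_localMemory_le h0 h1
  have hN : Tendsto N atTop atTop := by
    refine tendsto_atTop_mono' _ ?_ tendsto_id
    filter_upwards [hnum] with n hn
    have : n * 1 ≤ n * m n := Nat.mul_le_mul_left n hn.1
    simp only [id, hNdef]
    nlinarith
  have hDN : Tendsto (fun n => (D (N n) : ℝ)) atTop atTop :=
    (tendsto_atTop_of_log_isBigO hD_lower).comp hN
  have hr : Tendsto r atTop atTop :=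
    tendsto_nat_floor_atTop.comp ((hDN.const_mul_atTop hC).atTop_div_const two_pos)
  have hdiam := eventually_diameter_le hε hDε C hC (show 0 < γ by rw [hγ]; linarith) hN
    (hnum.mono fun n hn => hn.2.1)
  have hrn : ∀ᶠ n in atTop, r n ≤ n := by
    filter_upwards [hdiam, hnum, eventually_ge_atTop 1] with n h₁ h₂ hn
    have h₃ : n * (2 * m n) ≤ n * n := by
      have := h₂.2.1
      calc n * (2 * m n) = 2 * n * m n := by ring
        _ ≤ n ^ 2 := this
        _ = n * n := sq n
    have h₄ : 2 * r n + 1 ≤ m n := h₁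
    have := Nat.le_of_mul_le_mul_left h₃ hn
    omega
  have hT : (fun n => (A.rounds (N n) : ℝ)) =o[atTop] fun n => Real.log (r n : ℝ) :=
    (hrounds.comp_tendsto hN).trans_isBigO (log_isBigO_log_floor hDN hC)
  have hex : ∀ᶠ n in atTop, ∃ B : MPCAlgorithm,
      Fintype.card (B.Machine n) * localMemory ((2 + δ) / 3) n ≤ n ^ (2 * c + 7) ∧
      B.rounds n = 2 + (Nat.log (r n) n + 1) * (A.rounds (N n) + 6) ∧
      ∀ (G : SimpleGraph (Fin n)) (special : List (Fin n)) (ans : Bool),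
        oneVsTwoCycles.inst n G special ans →
        (∃ start : B.Machine n → List ℕ, IsInputDistribution G special start ∧
          ∀ i, (start i).length ≤ localMemory ((2 + δ) / 3) n) ∧
        ∀ start : B.Machine n → List ℕ, IsInputDistribution G special start →
          (∀ i, (start i).length ≤ localMemory ((2 + δ) / 3) n) →
          ∀ ω, B.Succeeds ((2 + δ) / 3) (2 * b + 2) n start ans ω := by
    filter_upwards [hnum, hdiam, hN.eventually hA, hN.eventually hmem, hr.eventually_ge_atTop 2,
      hN.eventually_ge_atTop 1, eventually_ge_atTop 4] with n h₁ h₂ h₃ h₄ h₅ h₆ hn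
    obtain ⟨hm1, hN2, hq, hmS, hAS⟩ := h₁
    have hrD : ((2 * r n : ℕ) : ℝ) ≤ C * D (N n) := by
      have := Nat.floor_le (show 0 ≤ C * D (N n) / 2 by positivity)
      push_cast
      simp only [hrdef]
      linarith
    have hrS : 16 * r n ≤ localMemory ((2 + δ) / 3) n := by
      have h₂' : 2 * r n + 1 ≤ m n := h₂
      exact le_trans (by omega : 16 * r n ≤ 16 * m n) hmS
    have hnW : 2 * n ≤ n ^ (2 * b + 2) := by
      calc 2 * n ≤ n * n := Nat.mul_le_mul_right n (by omega)
        _ = n ^ 2 := (sq n).symm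
        _ ≤ n ^ (2 * b + 2) := Nat.pow_le_pow_right (by omega) (by omega)
    have hAW : N n ^ b ≤ n ^ (2 * b + 2) := by
      calc N n ^ b ≤ (n ^ 2) ^ b := Nat.pow_le_pow_left hN2 b
        _ = n ^ (2 * b) := (pow_mul n 2 b).symm
        _ ≤ n ^ (2 * b + 2) := Nat.pow_le_pow_right (by omega) (by omega)
    obtain ⟨B, hB₁, hB₂, hB₃⟩ := exists_algorithm_at A (by omega) (by omega) hrD h₃
      (Nat.mul_le_mul_left _ h₂) (Nat.lt_succ_sqrt' (2 * n)).le hq hrS hAS hnW hAW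
      (Nat.lt_pow_succ_log_self (by omega) n)
    refine ⟨B, ?_, hB₂, hB₃⟩
    rw [hB₁]
    have hS : localMemory ((2 + δ) / 3) n ≤ n := by
      refine Nat.floor_le_of_le ?_
      calc (n : ℝ) ^ ((2 + δ) / 3) ≤ (n : ℝ) ^ (1 : ℝ) :=
            Real.rpow_le_rpow_of_exponent_le (by norm_cast; omega) (by linarith)
        _ = n := Real.rpow_one _
    refine globalMemory_le hn (by omega) hS ?_
    have hS1 : 1 ≤ localMemory δ (N n) := by
      rw [localMemory, Nat.one_le_floor_iff]
      exact Real.one_le_rpow (by exact_mod_cast h₆) h0.le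
    calc Fintype.card (A.Machine (N n)) ≤ Fintype.card (A.Machine (N n)) * localMemory δ (N n) :=
          Nat.le_mul_of_pos_right _ hS1
      _ ≤ N n ^ c := h₄
      _ ≤ (n ^ 2) ^ c := Nat.pow_le_pow_left hN2 c
      _ = n ^ (2 * c) := (pow_mul n 2 c).symm
  have : Nonempty MPCAlgorithm := ⟨A⟩
  obtain ⟨B, hB⟩ := hex.choice
  refine ⟨MPCAlgorithm.diagonal B, hB.mono fun n hn => hn.1, ?_, ?_⟩
  · filter_upwards [hB] with n hn G special ans hinst
    refine ⟨(hn.2.2 G special ans hinst).1, fun start hstart hfit => ?_⟩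
    have huniv : {ω | (MPCAlgorithm.diagonal B).Succeeds ((2 + δ) / 3) (2 * b + 2) n start ans ω} =
        Set.univ := Set.eq_univ_of_forall fun ω =>
      MPCAlgorithm.succeeds_diagonal B ((hn.2.2 G special ans hinst).2 start hstart hfit ω)
    rw [huniv, Set.ncard_univ, Nat.card_eq_fintype_card,
      div_self (by exact_mod_cast Fintype.card_ne_zero)]
    have : (0 : ℝ) ≤ 1 / n := by positivity
    linarith
  · refine (rounds_isLittleO hr hrn hT).congr' ?_ EventuallyEq.rfl
    filter_upwards [hB] with n hn
    change _ = ((B n).rounds n : ℝ)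
    rw [hn.2.1]

end Reduction

theorem mainTheorem6 (hconj : OneVsTwoCyclesConjecture)
    (D : ℕ → ℕ)
    (hD_lower : (fun n : ℕ => Real.log (n : ℝ)) =O[atTop] (fun n : ℕ => (D n : ℝ)))
    (hD_upper : ∃ ε : ℕ → ℝ, Tendsto ε atTop (𝓝 0) ∧
      ∀ᶠ n : ℕ in atTop, (D n : ℝ) = (n : ℝ) ^ ε n)
    (C : ℝ) (hC : 0 < C) :
    ¬ ∃ (A : MPCAlgorithm) (δ : ℝ) (b c : ℕ), 0 < δ ∧ δ < 1 ∧
      A.IsDeterministic ∧ A.GlobalMemoryLE δ c ∧ A.Solves δ b (pathConnectivity C D) ∧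
      (fun n : ℕ => (A.rounds n : ℝ)) =o[atTop] (fun n : ℕ => Real.log (D n : ℝ)) := by
  rintro ⟨A, δ, b, c, h0, h1, -, hmem, hA, hrounds⟩
  obtain ⟨B, hBmem, hB, hBrounds⟩ :=
    exists_fast_algorithm D hD_lower hD_upper C hC A δ b c h0 h1 hmem hA hrounds
  have hO := hconj _ _ _ B (by linarith) (by linarith) hBmem hB
  have h2 : Tendsto (fun k : ℕ => 2 * k) atTop atTop :=
    tendsto_id.const_mul_atTop' two_pos
  have hlog := hO.trans_isLittleO (hBrounds.comp_tendsto h2)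
  -- a function that is eventually nonzero is not negligible with respect to itself
  refine isLittleO_irrefl ?_ hlog
  refine (eventually_ge_atTop 1).frequently.mono fun k hk => ?_
  refine (Real.log_pos ?_).ne'
  exact_mod_cast (by omega : 1 < 2 * k)
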